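/- **Setting.** Let $V$ be a finite set of users and $s\in[-1,1]^V$ an unknown mean-centered vector ($\sum_v s_v=0$); put $\Theta^*=ss^\top$. Let $L_1,\dots,L_K$ be Laplacians of undirected graphs on $V$ with nonnegative edge weights. The arms are the forest matrices $X_i=(I+L_i)^{-1}$, and the loss of an arm is $f(X)=\langle\Theta^*,X\rangle=s^\top Xs$ (trace inner product). In each round $t=1,\dots,T$ the learner plays an arm $X_t$ and observes $Y_t=f(X_t)+\eta_t$, with $\eta_t$ i.i.d. $N(0,\sigma^2)$ and independent of the learner's private randomness. The regret is $R_T=\sum_{t=1}^T\bigl(f(X_t)-\min_i f(X_i)\bigr)$. Call a real $V\times V$ matrix *admissible* if it is symmetric and has the all-ones vector as an eigenvector (all $X_i$ and $\Theta^*$ are admissible). **Algorithm (OPD-Min-ESTR).** Fix $\delta\in(0,1)$ and a constant $b\ge 2\sigma$, $b>0$. *Stage 1:* in rounds $1,\dots,T_1$ pull arms by any design that is a function of the private randomness, and let $\widehat\Theta$ be an admissible minimizer, over all $\Theta\in\mathbb R^{V\times V}$, of $$\frac1{2T_1}\sum_{t=1}^{T_1}\bigl(Y_t-\langle X_t,\Theta\rangle\bigr)^2+\lambda\|\Theta\|_{\rm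 nuc},\qquad \lambda=b\sqrt{\frac{2\log(2|V|/\delta)}{T_1}} .$$ Let $\hat s$ be a unit eigenvector of $\widehat\Theta$ for its largest eigenvalue, and $\hat S=[\hat s,\hat S_\perp]$ an orthogonal matrix. For a matrix $A$ let $x(A)\in\mathbb R^{k}$, $k=2|V|-1$, consist of the first row and the first column of $\hat S^\top A\hat S$. *Stage 2:* in rounds $T_1+1,\dots,T$ a linear bandit algorithm chooses among the arms with feature vectors $x(X_i)$, from these vectors, its randomness and the arms and losses seen in Stage 2. Its regret is $$R^{\rm sub}_T=\sum_{t=T_1+1}^{T}\bigl(\langle x(X_t),x(\Theta^*)\rangle-\min_i\langle x(X_i),x(\Theta^*)\rangle\bigr).$$ **Restricted strong convexity (RSC)** with curvature $\kappa>0$ and tolerance $\tau^2\ge0$: for all admissible $\Delta$ in the cone $\mathcal C$, $$\frac1{2T_1}\sum_{t=1}^{T_1}\langle X_t,\Delta\rangle^2\ \ge\ \frac\kappa2\|\Delta\|_F^2-\tau^2\|\Delta\|_{\rm nuc}^2 ,$$ where $\mathcal C=\{\Delta:\|\Delta_{\overline{\mathcal M}^\perp}\|_{\rm nuc}\le3\|\Delta_{\overline{\mathcal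 M}}\|_{\rm nuc}\}$, $\overline{\mathcal M}=\{sa^\top+bs^\top : a,b\in\mathbb R^V\}$, $\overline{\mathcal M}^\perp=\{B:Bs=0,\ s^\top B=0\}$, and the subscripts denote orthogonal projections. **Corollary (Regret bound with a lower bound on signal strength).** For all constants $c_{\rm lo},c_{\rm hi},c_\ell,c_\tau,b,c_{\rm sub}>0$ and $p_{\rm sub}\in\mathbb N$ there are $C,c_0>0$ and $p\in\mathbb N$, depending only on them, with the following property. Suppose that * $2\sigma\le b$, and a number $\ell_s>0$ with $c_\ell|V|\le\ell_s\le\|s\|^2$ is known; * $T_1\le T$ and $c_{\rm lo}Q\le T_1\le c_{\rm hi}Q$, where $Q=\frac1{\ell_s\kappa}\sqrt{T\log(2|V|/\delta)}$; * either $128\,\tau^2\le\kappa$, or else $\kappa\le1$, $\tau^2\le c_\tau\Bigl(\sqrt{\tfrac{\log(2|V|)}{T_1}}+\tfrac{\log(1/\delta)}{T_1}\Bigr)$ and $T\ge c_0\,\frac{\|s\|^4}{\kappa^2}\log\frac{2|V|}\delta$; * RSC with $(\kappa,\tau^2)$ holds with probability at least $1-\delta_1$; * $R^{\rm sub}_T\le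 c_{\rm sub}\,k\sqrt T\,\bigl(\log\tfrac{2|V|T}\delta\bigr)^{p_{\rm sub}}$ with probability at least $1-\delta_2$ (that is, $R_T^{\rm sub}=\tilde{\mathcal O}(k\sqrt T)$). Then with probability at least $1-\delta-\delta_1-\delta_2$ $$R_T\ \le\ C\,\frac{\sqrt{|V|\,T}}{\kappa}\Bigl(\log\frac{2|V|T}{\delta}\Bigr)^{p},\qquad\text{that is,}\qquad R_T=\tilde{\mathcal O}\Bigl(\frac1\kappa\sqrt{|V|\,T}\Bigr).$$ In particular, if RSC and the bound on $R_T^{\rm sub}$ hold almost surely ($\delta_1=\delta_2=0$), the regret bound holds with probability at least $1-\delta$. -/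

import Mathlib

open MeasureTheory ProbabilityTheory Matrix
open scoped NNReal ENNReal

noncomputable section

namespace OPDMin

/-- Real square matrices indexed by a user set with `m + 1` elements, so `|V| = m + 1`. -/
abbrev Mat (m : ℕ) := Matrix (Fin (m + 1)) (Fin (m + 1)) ℝ

/-! ### Matrix notions -/

/-- The trace inner product. -/
def traceInner {m : ℕ} (A B : Mat m) : ℝ := (Aᵀ * B).trace

/-- The squared Frobenius norm. -/
def frobSq {m : ℕ} (A : Mat m) : ℝ := traceInner A A

/-- The nuclear norm, the sum of the singular values. -/
def nucNorm {m : ℕ} (A : Mat m) : ℝ :=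
  ∑ i ∈ Finset.range (m + 1), (Matrix.toEuclideanLin A).singularValues i

/-- `v` is a unit eigenvector of `A` for the largest (real) eigenvalue of `A`. -/
def IsTopEigenvector {m : ℕ} (A : Mat m) (v : Fin (m + 1) → ℝ) : Prop :=
  v ⬝ᵥ v = 1 ∧ ∃ r : ℝ, A *ᵥ v = r • v ∧
    ∀ (q : ℝ) (u : Fin (m + 1) → ℝ), u ≠ 0 → A *ᵥ u = q • u → q ≤ r

/-- The symmetric matrices that have the all-ones vector as an eigenvector. Every forest matrix and
every `s sᵀ` with `s` mean-centered is of this kind. -/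
def IsAdmissible {m : ℕ} (D : Mat m) : Prop :=
  D.IsSymm ∧ ∃ c : ℝ, D *ᵥ (fun _ => 1) = c • (fun _ => (1 : ℝ))

/-! ### The opinion model -/

/-- Laplacian of an undirected graph on `Fin (m + 1)` with nonnegative edge weights `w i j`
(weight `0` means that there is no edge) and without loops. -/
def IsLaplacian {m : ℕ} (L : Mat m) : Prop :=
  ∃ w : Mat m, w.IsSymm ∧ (∀ i j, 0 ≤ w i j) ∧ (∀ i, w i i = 0) ∧
    L = Matrix.diagonal (fun i => ∑ j, w i j) - w

/-- The forest matrix `(I + L)⁻¹`. -/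
def forest {m : ℕ} (L : Mat m) : Mat m := (1 + L)⁻¹

/-- An instance of online polarization and disagreement minimization: `K` admissible Laplacians and
a mean-centered innate opinion vector with entries in `[-1, 1]`. -/
structure Instance (m K : ℕ) where
  lap : Fin K → Mat m
  isLaplacian : ∀ i, IsLaplacian (lap i)
  s : Fin (m + 1) → ℝ
  s_mem : ∀ v, s v ∈ Set.Icc (-1 : ℝ) 1
  centered : ∑ v, s v = 0

/-- The arms: the forest matrices of the admissible Laplacians. -/
def Instance.arm {m K : ℕ} (P : Instance m K) (i : Fin K) : Mat m := forest (P.lap i)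

/-- The unknown parameter `Θ* = s sᵀ`. -/
def Instance.theta {m K : ℕ} (P : Instance m K) : Mat m := Matrix.vecMulVec P.s P.s

/-- The signal strength `‖s‖²`. -/
def Instance.signal {m K : ℕ} (P : Instance m K) : ℝ := P.s ⬝ᵥ P.s

/-- The loss `f(X) = ⟨Θ*, X⟩` of the arm with index `i`. -/
def Instance.loss {m K : ℕ} (P : Instance m K) (i : Fin K) : ℝ := traceInner P.theta (P.arm i)

/-! ### Restricted strong convexity -/

/-- The cone `‖D_{M̄⊥}‖_nuc ≤ 3 ‖D_{M̄}‖_nuc`, where `M̄` consists of the matrices `s aᵀ + b sᵀ`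
and `M̄⊥`, its orthogonal complement, of the matrices `B` with `B s = 0` and `sᵀ B = 0`. -/
def InCone {m : ℕ} (s : Fin (m + 1) → ℝ) (D : Mat m) : Prop :=
  ∃ (a b : Fin (m + 1) → ℝ) (B : Mat m), B *ᵥ s = 0 ∧ s ᵥ* B = 0 ∧
    D = (Matrix.vecMulVec s a + Matrix.vecMulVec b s) + B ∧
    nucNorm B ≤ 3 * nucNorm (Matrix.vecMulVec s a + Matrix.vecMulVec b s)

/-- Restricted strong convexity of the design `X` with curvature `κ` and tolerance `τ² = τsq`, over
the admissible matrices of the cone. -/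
def RSC {m T₁ : ℕ} (s : Fin (m + 1) → ℝ) (X : Fin T₁ → Mat m) (κ τsq : ℝ) : Prop :=
  ∀ D : Mat m, IsAdmissible D → InCone s D →
    κ / 2 * frobSq D - τsq * nucNorm D ^ 2 ≤
      1 / (2 * (T₁ : ℝ)) * ∑ t, traceInner (X t) D ^ 2

/-! ### The algorithm -/

/-- The regularization parameter `b √(2 log(2|V|/δ) / T₁)`. -/
def lam (m T₁ : ℕ) (b δ : ℝ) : ℝ := b * √(2 * Real.log (2 * ((m : ℝ) + 1) / δ) / (T₁ : ℝ))

/-- The nuclear-norm penalized least-squares objective. -/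
def objective {m T₁ : ℕ} (l : ℝ) (X : Fin T₁ → Mat m) (Y : Fin T₁ → ℝ) (Θ : Mat m) : ℝ :=
  1 / (2 * (T₁ : ℝ)) * ∑ t, (Y t - traceInner (X t) Θ) ^ 2 + l * nucNorm Θ

/-- Index set of the reduced vectors, with `2|V| - 1` elements. -/
abbrev RedIdx (m : ℕ) := Unit ⊕ (Fin m ⊕ Fin m)

/-- The reduced vector of `A`: rotate `A` to `Sᵀ A S` and keep the top left entry, the rest of the
first column and the rest of the first row. -/
def reduced {m : ℕ} (S A : Mat m) : RedIdx m → ℝ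
  | Sum.inl _ => (Sᵀ * A * S) 0 0
  | Sum.inr (Sum.inl i) => (Sᵀ * A * S) i.succ 0
  | Sum.inr (Sum.inr j) => (Sᵀ * A * S) 0 j.succ

/-- A linear bandit algorithm with `K` arms and features indexed by `ι`. From its private
randomness, the feature vectors of the arms and the history (arms played and losses observed so far,
oldest first) it computes the index of the next arm. -/
abbrev BanditAlgorithm (K : ℕ) (ι U : Type*) := U → (Fin K → ι → ℝ) → List (Fin K × ℝ) → Fin K

/-- The history after `r` rounds of the interaction of a decision rule with the feedback `fb`, where
`fb r i` is the loss observed if arm `i` is played in round `r`. -/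
def history {K : ℕ} (rule : List (Fin K × ℝ) → Fin K) (fb : ℕ → Fin K → ℝ) :
    ℕ → List (Fin K × ℝ)
  | 0 => []
  | r + 1 =>
    history rule fb r ++ [(rule (history rule fb r), fb r (rule (history rule fb r)))]

/-- A run of the explore-subspace-then-refine algorithm on the instance `P`, on the probability space
`(Ω, μ)`, with exploration length `T₁`, regularization parameter `lam m T₁ b δ` and noise law
`N(0, σ²)`. Rounds are numbered from `0`. -/
structure Run {m K : ℕ} (P : Instance m K) (T₁ : ℕ) (b δ : ℝ) (σ : ℝ≥0) (U : Type*) {Ω : Type*}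
    [MeasurableSpace U] [MeasurableSpace Ω] (μ : Measure Ω) where
  /-- The noise of round `t`. -/
  noise : ℕ → Ω → ℝ
  measurable_noise : ∀ t, Measurable (noise t)
  noise_law : ∀ t, μ.map (noise t) = gaussianReal 0 (σ ^ 2)
  noise_indep : iIndepFun noise μ
  /-- The private randomness of the learner. -/
  seed : Ω → U
  measurable_seed : Measurable seed
  seed_indep : IndepFun seed (fun ω t => noise t ω) μ
  /-- The arms pulled in the exploration stage, an arbitrary randomized design. -/
  explore : U → Fin T₁ → Fin K
  measurable_explore : ∀ t, Measurable (fun u => explore u t)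
  /-- The estimator: a minimizer of the objective over all matrices, taken symmetric and with the
  all-ones vector as an eigenvector (some minimizer is always of this kind). -/
  thetaHat : Ω → Mat m
  thetaHat_admissible : ∀ ω, IsAdmissible (thetaHat ω)
  thetaHat_min : ∀ ω Θ,
    objective (lam m T₁ b δ) (fun t => P.arm (explore (seed ω) t))
        (fun t => P.loss (explore (seed ω) t) + noise t ω) (thetaHat ω) ≤
      objective (lam m T₁ b δ) (fun t => P.arm (explore (seed ω) t))
        (fun t => P.loss (explore (seed ω) t) + noise t ω) Θ
  /-- The rotation `[ŝ, Ŝ⊥]`: an orthogonal matrix whose first column `ŝ` is a top eigenvector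
  of the estimator. -/
  rot : Ω → Mat m
  rot_orthogonal : ∀ ω, (rot ω)ᵀ * rot ω = 1
  rot_top : ∀ ω, IsTopEigenvector (thetaHat ω) (fun v => rot ω v 0)
  /-- The linear bandit algorithm of the second stage, in dimension `2|V| - 1`. -/
  bandit : BanditAlgorithm K (RedIdx m) U

namespace Run

variable {m K : ℕ} {P : Instance m K} {T₁ : ℕ} {b δ : ℝ} {σ : ℝ≥0} {U Ω : Type*}
  [MeasurableSpace U] [MeasurableSpace Ω] {μ : Measure Ω}

/-- The matrices `X_t` pulled in the exploration stage. -/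
def design (R : Run P T₁ b δ σ U μ) (ω : Ω) (t : Fin T₁) : Mat m := P.arm (R.explore (R.seed ω) t)

/-- The reduced arms. -/
def redArm (R : Run P T₁ b δ σ U μ) (ω : Ω) (i : Fin K) : RedIdx m → ℝ :=
  reduced (R.rot ω) (P.arm i)

/-- The reduced parameter `θ*_sub`. -/
def redTheta (R : Run P T₁ b δ σ U μ) (ω : Ω) : RedIdx m → ℝ := reduced (R.rot ω) P.theta

/-- The decision rule of the second stage, given the outcome of the first. -/
def rule (R : Run P T₁ b δ σ U μ) (ω : Ω) : List (Fin K × ℝ) → Fin K :=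
  R.bandit (R.seed ω) (R.redArm ω)

/-- The index of the arm played in round `t`. -/
def played (R : Run P T₁ b δ σ U μ) (t : ℕ) (ω : Ω) : Fin K :=
  if h : t < T₁ then R.explore (R.seed ω) ⟨t, h⟩
  else R.rule ω (history (R.rule ω) (fun r i => P.loss i + R.noise (T₁ + r) ω) (t - T₁))

/-- The cumulative regret over the rounds `0, …, T - 1`. -/
def regret (R : Run P T₁ b δ σ U μ) (T : ℕ) (ω : Ω) : ℝ :=
  ∑ t ∈ Finset.range T, (P.loss (R.played t ω) - ⨅ i, P.loss i)

/-- The regret of the second stage as a linear bandit in the reduced space, that is for the losses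
`⟨x, θ*_sub⟩` of the reduced arms `x`. -/
def subRegret (R : Run P T₁ b δ σ U μ) (T : ℕ) (ω : Ω) : ℝ :=
  ∑ t ∈ Finset.Ico T₁ T,
    (R.redArm ω (R.played t ω) ⬝ᵥ R.redTheta ω - ⨅ i, R.redArm ω i ⬝ᵥ R.redTheta ω)

end Run

end OPDMin

end

noncomputable section

namespace OPDMin

/-! ### Dot products -/

/-! Write `n = |V|`, `L = log (2n/δ)`, and let `v` be the squared length of the part of `s`
orthogonal to the estimated direction. A forest matrix satisfies `0 ≤ X ≤ I`, so each exploration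
round costs at most `‖s‖²`, and dropping the lower right block of the rotated matrices lowers a loss
by an amount in `[0, v]`. Hence `R_T ≤ T₁ ‖s‖² + T v + R_sub` (`Run.regret_le`).

The angle `v` is controlled by the usual analysis of a nuclear-norm penalized estimator. If `λ`
dominates the noise, the error lies in the cone and RSC gives `‖Θ̂ - s sᵀ‖_F² ≤ 72 λ²/κ²`
(`RSC.frobSq_sub_le`). A variational comparison of `s` with the top eigenvector then gives `‖s‖² v ≤
2 ‖Θ̂ - s sᵀ‖_F²` (`IsTopEigenvector.mul_sub_sq_le`). For `T₁` of order `√(T L)/(ℓ κ)` and `ℓ`,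
`‖s‖²` of order `n`, both `T₁ ‖s‖²` and `T v` are of order `√(T L)/κ`.

Noise domination is a spectral tail bound for `∑ g_t A_t`. Mixed Gaussian moments are nonnegative
and traces of products of contractions are at most `n`, so the trace moments are at most `n` times
those of the scalar sum `∑ g_t` (`integral_trace_mul_pow_le`). Summing even moments into a `cosh`
gives the tail.

The remaining term `k √T` carries no `1/κ`. It is absorbed because RSC itself forces `κ = O(1/n)`
(`RSC.curvature_le`): the design has bounded total energy on the matrices `s aᵀ + a sᵀ`, which span
`n - 1` dimensions as `a` runs over the centered vectors. -/

theorem dotProduct_self_nonneg' {n : Type*} [Fintype n] (v : n → ℝ) : 0 ≤ v ⬝ᵥ v :=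
  Finset.sum_nonneg fun i _ => mul_self_nonneg (v i)

theorem dotProduct_le_sqrt_mul_sqrt {n : Type*} [Fintype n] (u v : n → ℝ) :
    u ⬝ᵥ v ≤ √(u ⬝ᵥ u) * √(v ⬝ᵥ v) := by
  simpa [dotProduct, pow_two] using Real.sum_mul_le_sqrt_mul_sqrt Finset.univ u v

theorem dotProduct_sq_le {n : Type*} [Fintype n] (u v : n → ℝ) :
    (u ⬝ᵥ v) ^ 2 ≤ (u ⬝ᵥ u) * (v ⬝ᵥ v) := by
  simpa [dotProduct, pow_two] using Finset.sum_mul_sq_le_sq_mul_sq Finset.univ u v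

/-! ### The trace inner product -/

section TraceInner

variable {m : ℕ}

theorem traceInner_eq_sum (A B : Mat m) : traceInner A B = ∑ i, ∑ j, A j i * B j i := by
  simp [traceInner, Matrix.trace, Matrix.mul_apply]

theorem traceInner_comm (A B : Mat m) : traceInner A B = traceInner B A := by
  simp [traceInner_eq_sum, mul_comm]

theorem traceInner_add_right (A B C : Mat m) :
    traceInner A (B + C) = traceInner A B + traceInner A C := by
  simp [traceInner, Matrix.mul_add]

theorem traceInner_sub_right (A B C : Mat m) :
    traceInner A (B - C) = traceInner A B - traceInner A C := by
  simp [traceInner, Matrix.mul_sub]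

theorem traceInner_smul_right (r : ℝ) (A B : Mat m) :
    traceInner A (r • B) = r * traceInner A B := by
  simp [traceInner]

theorem traceInner_add_left (A B C : Mat m) :
    traceInner (A + B) C = traceInner A C + traceInner B C := by
  simp [traceInner, Matrix.add_mul]

theorem traceInner_smul_left (r : ℝ) (A B : Mat m) :
    traceInner (r • A) B = r * traceInner A B := by
  simp [traceInner]

theorem traceInner_sum_left {ι : Type*} (S : Finset ι) (A : ι → Mat m) (B : Mat m) :
    traceInner (∑ i ∈ S, A i) B = ∑ i ∈ S, traceInner (A i) B := by
  simp [traceInner, Matrix.transpose_sum, Finset.sum_mul, Matrix.trace_sum]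

theorem traceInner_vecMulVec (A : Mat m) (u v : Fin (m + 1) → ℝ) :
    traceInner A (vecMulVec u v) = u ⬝ᵥ A *ᵥ v := by
  simp only [traceInner_eq_sum, vecMulVec_apply, dotProduct, mulVec, Finset.mul_sum]
  rw [Finset.sum_comm]
  exact Finset.sum_congr rfl fun i _ => Finset.sum_congr rfl fun j _ => by ring

theorem frobSq_nonneg (A : Mat m) : 0 ≤ frobSq A := by
  rw [frobSq, traceInner_eq_sum]
  exact Finset.sum_nonneg fun i _ => Finset.sum_nonneg fun j _ => mul_self_nonneg _

theorem traceInner_sq_le (A B : Mat m) : traceInner A B ^ 2 ≤ frobSq A * frobSq B := by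
  have h := Finset.sum_mul_sq_le_sq_mul_sq (Finset.univ ×ˢ Finset.univ)
    (fun p : Fin (m + 1) × Fin (m + 1) => A p.1 p.2) (fun p => B p.1 p.2)
  simp only [Finset.sum_product_right] at h
  simpa only [frobSq, traceInner_eq_sum, pow_two] using h

theorem frobSq_add (A B : Mat m) :
    frobSq (A + B) = frobSq A + 2 * traceInner A B + frobSq B := by
  simp only [frobSq, traceInner_add_left, traceInner_add_right, traceInner_comm B A]
  ring

end TraceInner

/-! ### The nuclear norm and its dual -/

/-- `A` has spectral norm at most `|c|`. -/
def IsContraction {m : ℕ} (c : ℝ) (A : Mat m) : Prop :=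
  ∀ v, (A *ᵥ v) ⬝ᵥ (A *ᵥ v) ≤ c ^ 2 * (v ⬝ᵥ v)

section NuclearNorm

variable {m : ℕ}

theorem mulVec_dotProduct_mulVec (A B : Mat m) (u v : Fin (m + 1) → ℝ) :
    (A *ᵥ u) ⬝ᵥ (B *ᵥ v) = u ⬝ᵥ (Aᵀ * B) *ᵥ v := by
  rw [← mulVec_mulVec, dotProduct_mulVec u, vecMul_transpose]

theorem dotProduct_mulVec_of_orthogonal {V : Mat m} (hV : Vᵀ * V = 1) (u v : Fin (m + 1) → ℝ) :
    (V *ᵥ u) ⬝ᵥ (V *ᵥ v) = u ⬝ᵥ v := by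
  rw [mulVec_dotProduct_mulVec, hV, one_mulVec]

/-- An eigenbasis of `AᵀA` serves as the columns of `V`; the columns of `A V` are then orthogonal
with the singular values as lengths. This half of the singular value decomposition suffices for
duality. -/
theorem exists_singular_frame (A : Mat m) : ∃ (V : Mat m) (d : Fin (m + 1) → ℝ),
    Vᵀ * V = 1 ∧ (∀ i, 0 ≤ d i) ∧ (A * V)ᵀ * (A * V) = diagonal (fun i => d i ^ 2) ∧
      nucNorm A = ∑ i, d i := by
  set T := Matrix.toEuclideanLin A with hT
  have hn : Module.finrank ℝ (EuclideanSpace ℝ (Fin (m + 1))) = m + 1 := by simp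
  set e := T.isSymmetric_adjoint_comp_self.eigenvectorBasis hn with he
  refine ⟨Matrix.of fun i j => e j i, fun i => T.singularValues i, ?_,
    fun i => T.singularValues_nonneg _, ?_, ?_⟩
  · ext i j
    have := orthonormal_iff_ite.1 e.orthonormal i j
    simp only [PiLp.inner_apply, RCLike.inner_apply, conj_trivial] at this
    simp only [Matrix.mul_apply, Matrix.transpose_apply, Matrix.of_apply, Matrix.one_apply]
    rw [← this]
    exact Finset.sum_congr rfl fun k _ => mul_comm _ _
  · ext i j
    have h1 : ∀ j, (A * Matrix.of fun i j => e j i).col j = fun k => T (e j) k := by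
      intro j
      ext k
      simp [hT, Matrix.mul_apply, Matrix.toEuclideanLin, mulVec, dotProduct]
    have h2 : inner ℝ (T (e i)) (T (e j)) = if i = j then T.singularValues i ^ 2 else 0 := by
      rw [← LinearMap.adjoint_inner_right]
      have := T.isSymmetric_adjoint_comp_self.apply_eigenvectorBasis hn j
      rw [LinearMap.comp_apply, ← he] at this
      rw [this, inner_smul_right, orthonormal_iff_ite.1 e.orthonormal i j,
        ← T.sq_singularValues_fin hn]
      split_ifs with h
      · simp [h]
      · simp
    simp only [PiLp.inner_apply, RCLike.inner_apply, conj_trivial] at h2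
    rw [Matrix.mul_apply, diagonal_apply, ← h2]
    refine Finset.sum_congr rfl fun k _ => ?_
    have hi := congrFun (h1 i) k
    have hj := congrFun (h1 j) k
    simp only [Matrix.col_apply] at hi hj
    rw [Matrix.transpose_apply, hi, hj, mul_comm]
  · rw [nucNorm, ← hT, Finset.sum_range]

theorem nucNorm_nonneg (A : Mat m) : 0 ≤ nucNorm A :=
  Finset.sum_nonneg fun i _ => LinearMap.singularValues_nonneg _ i

theorem traceInner_conj {V : Mat m} (hV : Vᵀ * V = 1) (W A : Mat m) :
    traceInner W A = traceInner (W * V) (A * V) := by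
  have hV' : V * Vᵀ = 1 := mul_eq_one_comm.1 hV
  rw [traceInner, traceInner, transpose_mul, Matrix.mul_assoc, Matrix.trace_mul_comm Vᵀ,
    Matrix.mul_assoc, Matrix.mul_assoc, hV', Matrix.mul_one]

/-- Cauchy-Schwarz column by column in the right singular basis of `A`. -/
theorem traceInner_le_nucNorm {c : ℝ} (hc : 0 ≤ c) {W : Mat m} (hW : IsContraction c W)
    (A : Mat m) : traceInner W A ≤ c * nucNorm A := by
  obtain ⟨V, d, hV, hd, hAV, hnuc⟩ := exists_singular_frame A
  rw [traceInner_conj hV, hnuc, Finset.mul_sum]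
  rw [traceInner_eq_sum]
  refine Finset.sum_le_sum fun i _ => ?_
  have h1 : √(∑ j, (W * V) j i * (W * V) j i) ≤ c := by
    have h := hW (V.col i)
    have h2 : V.col i ⬝ᵥ V.col i = 1 := by
      have := congrFun (congrFun hV i) i
      simpa [Matrix.mul_apply, dotProduct] using this
    rw [h2, mul_one] at h
    rw [Real.sqrt_le_left hc]
    exact h
  have h2 : √(∑ j, (A * V) j i * (A * V) j i) = d i := by
    have := congrFun (congrFun hAV i) i
    rw [Matrix.mul_apply, diagonal_apply_eq] at this
    simp only [transpose_apply] at this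
    rw [this, Real.sqrt_sq (hd i)]
  calc ∑ j, (W * V) j i * (A * V) j i
      ≤ √(∑ j, (W * V) j i * (W * V) j i) * √(∑ j, (A * V) j i * (A * V) j i) :=
        dotProduct_le_sqrt_mul_sqrt (fun j => (W * V) j i) (fun j => (A * V) j i)
    _ ≤ c * d i := by
        rw [h2]
        exact mul_le_mul_of_nonneg_right h1 (hd i)

theorem exists_dual (A : Mat m) : ∃ W : Mat m, IsContraction 1 W ∧ traceInner W A = nucNorm A := by
  obtain ⟨V, d, hV, hd, hAV, hnuc⟩ := exists_singular_frame A
  have hV' : V * Vᵀ = 1 := mul_eq_one_comm.1 hV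
  -- The polar factor of `A`. Since `0⁻¹ = 0`, it vanishes on the kernel of `A` and is a partial
  -- isometry.
  refine ⟨A * V * diagonal (fun i => (d i)⁻¹) * Vᵀ, fun v => ?_, ?_⟩
  · rw [mulVec_dotProduct_mulVec]
    have : (A * V * diagonal (fun i => (d i)⁻¹) * Vᵀ)ᵀ * (A * V * diagonal (fun i => (d i)⁻¹) * Vᵀ)
        = V * diagonal (fun i => (d i)⁻¹ * d i ^ 2 * (d i)⁻¹) * Vᵀ := by
      calc _ = V * (diagonal (fun i => (d i)⁻¹) * ((A * V)ᵀ * (A * V)) *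
            diagonal (fun i => (d i)⁻¹)) * Vᵀ := by
            simp only [transpose_mul, transpose_transpose, diagonal_transpose, Matrix.mul_assoc]
        _ = _ := by rw [hAV, diagonal_mul_diagonal, diagonal_mul_diagonal]
    rw [this, ← mulVec_mulVec, ← mulVec_mulVec, dotProduct_mulVec, ← mulVec_transpose]
    have h2 : v ⬝ᵥ v = (Vᵀ *ᵥ v) ⬝ᵥ (Vᵀ *ᵥ v) := by
      rw [mulVec_dotProduct_mulVec, transpose_transpose, hV', one_mulVec]
    rw [h2, one_pow, one_mul]
    refine Finset.sum_le_sum fun i _ => ?_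
    rw [mulVec_diagonal]
    have h3 : (d i)⁻¹ * d i ^ 2 * (d i)⁻¹ ≤ 1 := by
      rcases eq_or_ne (d i) 0 with h | h
      · simp [h]
      · apply le_of_eq
        field_simp
    nlinarith [mul_self_nonneg ((Vᵀ *ᵥ v) i)]
  · rw [traceInner_conj hV, hnuc, Matrix.mul_assoc, hV, Matrix.mul_one, traceInner, transpose_mul,
      Matrix.mul_assoc, hAV, diagonal_transpose, diagonal_mul_diagonal, trace_diagonal]
    refine Finset.sum_congr rfl fun i _ => ?_
    rcases eq_or_ne (d i) 0 with h | h
    · simp [h]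
    · field_simp

theorem nucNorm_le_of_forall {A : Mat m} {r : ℝ}
    (h : ∀ W : Mat m, IsContraction 1 W → traceInner W A ≤ r) : nucNorm A ≤ r := by
  obtain ⟨W, hW, h'⟩ := exists_dual A
  exact h' ▸ h W hW

theorem nucNorm_add_le (A B : Mat m) : nucNorm (A + B) ≤ nucNorm A + nucNorm B := by
  refine nucNorm_le_of_forall fun W hW => ?_
  have h1 := traceInner_le_nucNorm zero_le_one hW A
  have h2 := traceInner_le_nucNorm zero_le_one hW B
  rw [traceInner_add_right]
  linarith

theorem IsContraction.neg {c : ℝ} {W : Mat m} (hW : IsContraction c W) : IsContraction c (-W) :=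
  fun v => by simpa [neg_mulVec] using hW v

theorem nucNorm_neg (A : Mat m) : nucNorm (-A) = nucNorm A := by
  have key : ∀ A : Mat m, nucNorm (-A) ≤ nucNorm A := fun A => by
    refine nucNorm_le_of_forall fun W hW => ?_
    have := traceInner_le_nucNorm zero_le_one hW.neg A
    simpa [traceInner] using this
  refine le_antisymm (key A) ?_
  simpa using key (-A)

theorem nucNorm_zero : nucNorm (0 : Mat m) = 0 :=
  le_antisymm (nucNorm_le_of_forall fun W _ => by simp [traceInner]) (nucNorm_nonneg _)

theorem nucNorm_vecMulVec_le (u v : Fin (m + 1) → ℝ) :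
    nucNorm (vecMulVec u v) ≤ √(u ⬝ᵥ u) * √(v ⬝ᵥ v) := by
  refine nucNorm_le_of_forall fun W hW => ?_
  rw [traceInner_vecMulVec]
  refine (dotProduct_le_sqrt_mul_sqrt _ _).trans ?_
  gcongr
  simpa using hW v

theorem frobSq_vecMulVec_add (s a b : Fin (m + 1) → ℝ) :
    frobSq (vecMulVec s a + vecMulVec b s) =
      (s ⬝ᵥ s) * (a ⬝ᵥ a) + (b ⬝ᵥ b) * (s ⬝ᵥ s) + 2 * (s ⬝ᵥ b) * (a ⬝ᵥ s) := by
  have h (u v w x : Fin (m + 1) → ℝ) :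
      traceInner (vecMulVec u v) (vecMulVec w x) = (u ⬝ᵥ w) * (v ⬝ᵥ x) := by
    rw [traceInner_vecMulVec, vecMulVec_mulVec]
    simp [dotProduct_comm w u]
    ring
  rw [frobSq_add, frobSq, frobSq, h, h, h]
  ring

/-- With `b ⊥ s` the two rank-one terms are Frobenius-orthogonal, so the factor `2` is that of `(x +
y)² ≤ 2 (x² + y²)`. -/
theorem nucNorm_sq_le_two_mul_frobSq {s b : Fin (m + 1) → ℝ} (a : Fin (m + 1) → ℝ)
    (hb : s ⬝ᵥ b = 0) :
    nucNorm (vecMulVec s a + vecMulVec b s) ^ 2 ≤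
      2 * frobSq (vecMulVec s a + vecMulVec b s) := by
  rw [frobSq_vecMulVec_add, hb]
  have h := (nucNorm_add_le (vecMulVec s a) (vecMulVec b s)).trans
    (add_le_add (nucNorm_vecMulVec_le s a) (nucNorm_vecMulVec_le b s))
  have h' := pow_le_pow_left₀ (nucNorm_nonneg _) h 2
  have hs := Real.sq_sqrt (dotProduct_self_nonneg' s)
  have ha := Real.sq_sqrt (dotProduct_self_nonneg' a)
  have hb := Real.sq_sqrt (dotProduct_self_nonneg' b)
  have h3 : (√(s ⬝ᵥ s) * √(a ⬝ᵥ a)) ^ 2 = (s ⬝ᵥ s) * (a ⬝ᵥ a) := by rw [mul_pow, hs, ha]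
  have h4 : (√(b ⬝ᵥ b) * √(s ⬝ᵥ s)) ^ 2 = (b ⬝ᵥ b) * (s ⬝ᵥ s) := by rw [mul_pow, hs, hb]
  nlinarith [sq_nonneg (√(s ⬝ᵥ s) * √(a ⬝ᵥ a) - √(b ⬝ᵥ b) * √(s ⬝ᵥ s))]

/-- The nuclear norm is additive on `s sᵀ` and the matrices that vanish on `s` from both sides. -/
theorem le_nucNorm_add_of_orthogonal {s : Fin (m + 1) → ℝ} (hs : 0 < s ⬝ᵥ s) {B : Mat m}
    (h1 : B *ᵥ s = 0) (h2 : s ᵥ* B = 0) :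
    s ⬝ᵥ s + nucNorm B ≤ nucNorm (vecMulVec s s + B) := by
  obtain ⟨W, hW, hWB⟩ := exists_dual B
  set q := s ⬝ᵥ s with hq
  set Q : Mat m := 1 - q⁻¹ • vecMulVec s s with hQ
  have hQv (v : Fin (m + 1) → ℝ) : Q *ᵥ v = v - (q⁻¹ * (s ⬝ᵥ v)) • s := by
    rw [hQ, sub_mulVec, one_mulVec, smul_mulVec, vecMulVec_mulVec, mul_smul]
    simp
  have hQs : Q *ᵥ s = 0 := by
    rw [hQv, ← hq, inv_mul_cancel₀ hs.ne', one_smul, sub_self]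
  have hQt : Qᵀ = Q := by
    rw [hQ, transpose_sub, transpose_one, transpose_smul, transpose_vecMulVec]
  have hsQ (v : Fin (m + 1) → ℝ) : s ⬝ᵥ Q *ᵥ v = 0 := by
    rw [dotProduct_mulVec, ← mulVec_transpose, hQt, hQs, zero_dotProduct]
  have hQn (v : Fin (m + 1) → ℝ) : (Q *ᵥ v) ⬝ᵥ (Q *ᵥ v) = v ⬝ᵥ v - q⁻¹ * (s ⬝ᵥ v) ^ 2 := by
    have := hsQ v
    nth_rewrite 1 [hQv]
    rw [sub_dotProduct, smul_dotProduct, this, hQv, dotProduct_sub, dotProduct_smul,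
      dotProduct_comm v s]
    simp only [smul_eq_mul]
    ring
  have hBQ : B * Q = B := by
    rw [hQ, Matrix.mul_sub, Matrix.mul_one, Matrix.mul_smul, mul_vecMulVec, h1]
    simp
  have hQB : Q * B = B := by
    rw [hQ, Matrix.sub_mul, Matrix.one_mul, Matrix.smul_mul, vecMulVec_mul, h2]
    simp
  -- Dual certificate: `Q` projects off `s`, so the two summands act on orthogonal subspaces, and
  -- the pairing with `s sᵀ + B` attains `q + ‖B‖_nuc`.
  have hcon : IsContraction 1 (q⁻¹ • vecMulVec s s + Q * W * Q) := fun v => by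
    have e1 : (q⁻¹ • vecMulVec s s + Q * W * Q) *ᵥ v
        = (q⁻¹ * (s ⬝ᵥ v)) • s + Q *ᵥ (W *ᵥ (Q *ᵥ v)) := by
      rw [add_mulVec, smul_mulVec, vecMulVec_mulVec, mulVec_mulVec, mulVec_mulVec, mul_smul,
        Matrix.mul_assoc]
      simp
    have e5 (x : Fin (m + 1) → ℝ) : (Q *ᵥ x) ⬝ᵥ s = 0 := by rw [dotProduct_comm, hsQ]
    rw [e1]
    simp only [add_dotProduct, dotProduct_add, smul_dotProduct, dotProduct_smul, hsQ, e5, hQn,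
      ← hq]
    have e2 := hW (Q *ᵥ v)
    rw [hQn] at e2
    have e3 : 0 ≤ q⁻¹ * (s ⬝ᵥ W *ᵥ (Q *ᵥ v)) ^ 2 := by positivity
    have e4 : (q⁻¹ * (s ⬝ᵥ v)) * ((q⁻¹ * (s ⬝ᵥ v)) * q) = q⁻¹ * (s ⬝ᵥ v) ^ 2 := by
      field_simp
    simp only [smul_eq_mul, add_zero, zero_add, mul_zero]
    rw [e4]
    linarith
  have h3 := traceInner_le_nucNorm zero_le_one hcon (vecMulVec s s + B)
  have h4 : traceInner (q⁻¹ • vecMulVec s s + Q * W * Q) (vecMulVec s s + B) = q + nucNorm B := by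
    rw [traceInner_add_right, traceInner_vecMulVec, add_mulVec, ← mulVec_mulVec, hQs, mulVec_zero,
      add_zero, smul_mulVec, vecMulVec_mulVec, traceInner_add_left, traceInner_smul_left,
      traceInner_comm _ B, traceInner_vecMulVec, h1, ← hWB]
    have : traceInner (Q * W * Q) B = traceInner W B := by
      rw [traceInner, transpose_mul, transpose_mul, hQt, Matrix.mul_assoc, Matrix.mul_assoc, hQB,
        Matrix.trace_mul_comm, Matrix.mul_assoc, hBQ, traceInner]
    rw [this]
    simp only [dotProduct_smul, dotProduct_zero, op_smul_eq_smul, smul_eq_mul, ← hq]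
    field_simp
    ring
  linarith

end NuclearNorm

/-! ### Forest matrices -/

section Forest

variable {m : ℕ}

theorem IsLaplacian.isSymm {L : Mat m} (hL : IsLaplacian L) : L.IsSymm := by
  obtain ⟨w, hw, -, -, rfl⟩ := hL
  exact (isSymm_diagonal _).sub hw

theorem IsLaplacian.dotProduct_mulVec_nonneg {L : Mat m} (hL : IsLaplacian L)
    (v : Fin (m + 1) → ℝ) : 0 ≤ v ⬝ᵥ L *ᵥ v := by
  obtain ⟨w, hw, hw0, -, rfl⟩ := hL
  have h1 : v ⬝ᵥ (diagonal (fun i => ∑ j, w i j) - w) *ᵥ v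
      = ∑ i, ∑ j, w i j * (v i * v i - v i * v j) := by
    rw [sub_mulVec, dotProduct_sub, dotProduct, dotProduct, ← Finset.sum_sub_distrib]
    refine Finset.sum_congr rfl fun i _ => ?_
    rw [mulVec_diagonal, mulVec, dotProduct, Finset.mul_sum, Finset.sum_mul, Finset.mul_sum,
      ← Finset.sum_sub_distrib]
    exact Finset.sum_congr rfl fun j _ => by ring
  have h2 : ∑ i, ∑ j, w i j * (v i * v i - v i * v j)
      = ∑ i, ∑ j, w i j * (v j * v j - v i * v j) := by
    rw [Finset.sum_comm]
    refine Finset.sum_congr rfl fun i _ => Finset.sum_congr rfl fun j _ => ?_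
    rw [hw.apply i j]
    ring
  have h3 : 0 ≤ ∑ i, ∑ j, w i j * (v i - v j) ^ 2 :=
    Finset.sum_nonneg fun i _ => Finset.sum_nonneg fun j _ =>
      mul_nonneg (hw0 i j) (sq_nonneg _)
  have h4 : ∑ i, ∑ j, w i j * (v i - v j) ^ 2
      = ∑ i, ∑ j, w i j * (v i * v i - v i * v j) + ∑ i, ∑ j, w i j * (v j * v j - v i * v j) := by
    simp only [← Finset.sum_add_distrib]
    exact Finset.sum_congr rfl fun i _ => Finset.sum_congr rfl fun j _ => by ring
  linarith

theorem IsLaplacian.mul_forest {L : Mat m} (hL : IsLaplacian L) : (1 + L) * forest L = 1 := by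
  have h : (1 + L).PosDef := by
    refine PosDef.of_dotProduct_mulVec_pos ?_ fun x hx => ?_
    · rw [IsHermitian, conjTranspose_eq_transpose_of_trivial, transpose_add, transpose_one,
        hL.isSymm]
    · rw [star_trivial, add_mulVec, one_mulVec, dotProduct_add]
      have h1 := hL.dotProduct_mulVec_nonneg x
      have h2 : 0 < x ⬝ᵥ x := by
        refine lt_of_le_of_ne (dotProduct_self_nonneg' x) fun h => hx ?_
        exact dotProduct_self_eq_zero.1 h.symm
      linarith
  exact mul_nonsing_inv _ ((isUnit_iff_isUnit_det _).1 h.isUnit)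

theorem IsLaplacian.mulVec_forest {L : Mat m} (hL : IsLaplacian L) (v : Fin (m + 1) → ℝ) :
    forest L *ᵥ v + L *ᵥ (forest L *ᵥ v) = v := by
  rw [mulVec_mulVec, ← add_mulVec]
  nth_rewrite 1 [← Matrix.one_mul (forest L)]
  rw [← Matrix.add_mul, hL.mul_forest, one_mulVec]

theorem IsLaplacian.isSymm_forest {L : Mat m} (hL : IsLaplacian L) : (forest L).IsSymm := by
  rw [IsSymm, forest, transpose_nonsing_inv, transpose_add, transpose_one, hL.isSymm]

/-- For `w = (I + L)⁻¹ v` one has `v = w + L w`, and expanding `‖v‖²` leaves `‖w‖²` plus nonnegative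
terms. -/
theorem IsLaplacian.isContraction_forest {L : Mat m} (hL : IsLaplacian L) :
    IsContraction 1 (forest L) := fun v => by
  have h1 := hL.dotProduct_mulVec_nonneg (forest L *ᵥ v)
  have h2 := dotProduct_self_nonneg' (L *ᵥ (forest L *ᵥ v))
  nth_rewrite 4 [← hL.mulVec_forest v]
  nth_rewrite 3 [← hL.mulVec_forest v]
  simp only [add_dotProduct, dotProduct_add]
  rw [dotProduct_comm (L *ᵥ (forest L *ᵥ v)) (forest L *ᵥ v)]
  linarith

theorem IsLaplacian.dotProduct_forest_mulVec {L : Mat m} (hL : IsLaplacian L)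
    (v : Fin (m + 1) → ℝ) : 0 ≤ v ⬝ᵥ forest L *ᵥ v ∧ v ⬝ᵥ forest L *ᵥ v ≤ v ⬝ᵥ v := by
  have h1 := hL.dotProduct_mulVec_nonneg (forest L *ᵥ v)
  have h2 := dotProduct_self_nonneg' (forest L *ᵥ v)
  have h3 := dotProduct_self_nonneg' (L *ᵥ (forest L *ᵥ v))
  have h4 := hL.mulVec_forest v
  set w := forest L *ᵥ v
  have h5 : v ⬝ᵥ w = w ⬝ᵥ w + w ⬝ᵥ L *ᵥ w := by
    rw [← h4, add_dotProduct, dotProduct_comm (L *ᵥ w) w]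
  have h6 : v ⬝ᵥ v = w ⬝ᵥ w + 2 * (w ⬝ᵥ L *ᵥ w) + (L *ᵥ w) ⬝ᵥ (L *ᵥ w) := by
    rw [← h4]
    simp only [add_dotProduct, dotProduct_add]
    rw [dotProduct_comm (L *ᵥ w) w]
    ring
  constructor <;> linarith

theorem Instance.loss_eq {K : ℕ} (P : Instance m K) (i : Fin K) :
    P.loss i = P.s ⬝ᵥ P.arm i *ᵥ P.s := by
  rw [Instance.loss, Instance.theta, traceInner_comm, traceInner_vecMulVec]

theorem Instance.loss_nonneg {K : ℕ} (P : Instance m K) (i : Fin K) : 0 ≤ P.loss i := by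
  rw [P.loss_eq]
  exact ((P.isLaplacian i).dotProduct_forest_mulVec _).1

theorem Instance.loss_le_signal {K : ℕ} (P : Instance m K) (i : Fin K) : P.loss i ≤ P.signal := by
  rw [P.loss_eq]
  exact ((P.isLaplacian i).dotProduct_forest_mulVec _).2

theorem Instance.signal_le {K : ℕ} (P : Instance m K) : P.signal ≤ (m : ℝ) + 1 := by
  have h : ∀ i ∈ Finset.univ, P.s i * P.s i ≤ 1 := fun i _ => by
    obtain ⟨h1, h2⟩ := P.s_mem i
    nlinarith
  simpa [Instance.signal, dotProduct] using Finset.sum_le_card_nsmul _ _ 1 h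

theorem Instance.isAdmissible_theta {K : ℕ} (P : Instance m K) : IsAdmissible P.theta := by
  refine ⟨transpose_vecMulVec _ _, 0, ?_⟩
  rw [Instance.theta, vecMulVec_mulVec]
  have : P.s ⬝ᵥ (fun _ => 1) = 0 := by simpa [dotProduct] using P.centered
  simp [this]

end Forest

/-! ### The reduced problem -/

section Reduced

variable {m : ℕ}

/-- Orthogonal conjugation preserves the trace product; the double sum is the block that the reduced
vectors discard. -/
theorem traceInner_eq_reduced_add {S : Mat m} (hS : Sᵀ * S = 1) (A B : Mat m) :
    traceInner A B = reduced S A ⬝ᵥ reduced S B +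
      ∑ i : Fin m, ∑ j : Fin m,
        (Sᵀ * A * S) i.succ j.succ * (Sᵀ * B * S) i.succ j.succ := by
  have hS' : S * Sᵀ = 1 := mul_eq_one_comm.1 hS
  have h1 : traceInner A B = traceInner (Sᵀ * A * S) (Sᵀ * B * S) := by
    rw [← traceInner_conj hS, traceInner, traceInner, transpose_mul, transpose_transpose,
      Matrix.mul_assoc, ← Matrix.mul_assoc S, hS', Matrix.one_mul]
  rw [h1, traceInner_eq_sum, Finset.sum_comm, Fin.sum_univ_succ, Fin.sum_univ_succ]
  simp only [Fin.sum_univ_succ (n := m), Finset.sum_add_distrib]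
  simp only [dotProduct, Fintype.sum_sum_type, reduced, Finset.univ_unique, Finset.sum_singleton]
  ring

/-- Passing from the quadratic form of `X` at `s` to the reduced vectors loses at most the squared
norm of the part of `s` orthogonal to the first column of the rotation. -/
theorem traceInner_sub_reduced_mem_Icc {S : Mat m} (hS : Sᵀ * S = 1) (s : Fin (m + 1) → ℝ)
    {X : Mat m} (hX : ∀ v, 0 ≤ v ⬝ᵥ X *ᵥ v ∧ v ⬝ᵥ X *ᵥ v ≤ v ⬝ᵥ v) :
    traceInner (vecMulVec s s) X - reduced S X ⬝ᵥ reduced S (vecMulVec s s) ∈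
      Set.Icc 0 (s ⬝ᵥ s - ((fun v => S v 0) ⬝ᵥ s) ^ 2) := by
  have hS' : S * Sᵀ = 1 := mul_eq_one_comm.1 hS
  set y := Sᵀ *ᵥ s with hy
  -- `S z` is the part of `s` orthogonal to the first column of `S`. The discarded block is exactly
  -- the quadratic form of `X` there.
  set z : Fin (m + 1) → ℝ := Fin.cons 0 (fun i => y i.succ) with hz
  have hyy : s ⬝ᵥ s = y ⬝ᵥ y := by
    rw [hy, mulVec_dotProduct_mulVec, transpose_transpose, hS', one_mulVec]
  have hy0 : (fun v => S v 0) ⬝ᵥ s = y 0 := rfl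
  have hzz : z ⬝ᵥ z = s ⬝ᵥ s - ((fun v => S v 0) ⬝ᵥ s) ^ 2 := by
    rw [hyy, hy0]
    simp only [dotProduct, Fin.sum_univ_succ, hz, Fin.cons_zero, Fin.cons_succ]
    ring
  have hSz : (S *ᵥ z) ⬝ᵥ (S *ᵥ z) = z ⬝ᵥ z := dotProduct_mulVec_of_orthogonal hS z z
  have hrot : Sᵀ * vecMulVec s s * S = vecMulVec y y := by
    rw [mul_vecMulVec, vecMulVec_mul, ← mulVec_transpose]
  have key : traceInner (vecMulVec s s) X - reduced S X ⬝ᵥ reduced S (vecMulVec s s)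
      = (S *ᵥ z) ⬝ᵥ X *ᵥ (S *ᵥ z) := by
    rw [traceInner_eq_reduced_add hS, dotProduct_comm (reduced S X), add_sub_cancel_left, hrot]
    have : (S *ᵥ z) ⬝ᵥ X *ᵥ (S *ᵥ z) = z ⬝ᵥ (Sᵀ * X * S) *ᵥ z := by
      rw [mulVec_mulVec, mulVec_dotProduct_mulVec, Matrix.mul_assoc]
    rw [this]
    simp only [dotProduct, mulVec, Fin.sum_univ_succ, hz, Fin.cons_zero, Fin.cons_succ,
      vecMulVec_apply, mul_zero, zero_mul, zero_add, Finset.mul_sum,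
      Finset.sum_const_zero]
    exact Finset.sum_congr rfl fun i _ => Finset.sum_congr rfl fun j _ => by ring
  rw [key, ← hzz, ← hSz]
  exact hX _

end Reduced

/-! ### Symmetric matrices and even powers -/

section EvenPowers

variable {m : ℕ}

theorem exists_orthogonal_diagonalization {S : Mat m} (hS : S.IsSymm) :
    ∃ (V : Mat m) (d : Fin (m + 1) → ℝ), Vᵀ * V = 1 ∧ S = V * diagonal d * Vᵀ := by
  have hS' : S.IsHermitian := by
    rwa [IsHermitian, conjTranspose_eq_transpose_of_trivial]
  refine ⟨hS'.eigenvectorUnitary, hS'.eigenvalues, ?_, ?_⟩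
  · have := (mem_unitaryGroup_iff'.1 hS'.eigenvectorUnitary.2)
    rwa [star_eq_conjTranspose, conjTranspose_eq_transpose_of_trivial] at this
  · have := hS'.spectral_theorem
    rw [Unitary.conjStarAlgAut_apply, star_eq_conjTranspose,
      conjTranspose_eq_transpose_of_trivial] at this
    exact this

theorem conj_diagonal_pow {V : Mat m} (hV : Vᵀ * V = 1) (d : Fin (m + 1) → ℝ) (k : ℕ) :
    (V * diagonal d * Vᵀ) ^ k = V * diagonal (fun i => d i ^ k) * Vᵀ := by
  induction k with
  | zero =>
    have hV' : V * Vᵀ = 1 := mul_eq_one_comm.1 hV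
    simp [hV']
  | succ k ih =>
    rw [pow_succ, ih]
    calc V * diagonal (fun i => d i ^ k) * Vᵀ * (V * diagonal d * Vᵀ)
        = V * (diagonal (fun i => d i ^ k) * (Vᵀ * V) * diagonal d) * Vᵀ := by
          simp only [Matrix.mul_assoc]
      _ = _ := by
          rw [hV, Matrix.mul_one, diagonal_mul_diagonal]
          simp only [pow_succ]

theorem trace_conj_diagonal {V : Mat m} (hV : Vᵀ * V = 1) (d : Fin (m + 1) → ℝ) :
    (V * diagonal d * Vᵀ).trace = ∑ i, d i := by
  rw [Matrix.trace_mul_comm, ← Matrix.mul_assoc, hV, Matrix.one_mul, trace_diagonal]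

theorem trace_pow_two_mul_nonneg {S : Mat m} (hS : S.IsSymm) (q : ℕ) :
    0 ≤ (S ^ (2 * q)).trace := by
  obtain ⟨V, d, hV, rfl⟩ := exists_orthogonal_diagonalization hS
  rw [conj_diagonal_pow hV, trace_conj_diagonal hV]
  exact Finset.sum_nonneg fun i _ => (even_two_mul q).pow_nonneg _

/-- Some eigenvalue has modulus at least `c`, and in an even power the other eigenvalues only add to
the trace. -/
theorem pow_le_trace_pow {S : Mat m} (hS : S.IsSymm) {c : ℝ} (hc : 0 ≤ c)
    (h : ¬ IsContraction c S) (q : ℕ) : c ^ (2 * q) ≤ (S ^ (2 * q)).trace := by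
  obtain ⟨V, d, hV, rfl⟩ := exists_orthogonal_diagonalization hS
  have hV' : V * Vᵀ = 1 := mul_eq_one_comm.1 hV
  rw [conj_diagonal_pow hV, trace_conj_diagonal hV]
  have : ∃ i, c ≤ |d i| := by
    by_contra! hd
    refine h fun v => ?_
    have h2 : v ⬝ᵥ v = (Vᵀ *ᵥ v) ⬝ᵥ (Vᵀ *ᵥ v) := by
      rw [mulVec_dotProduct_mulVec, transpose_transpose, hV', one_mulVec]
    rw [← mulVec_mulVec, ← mulVec_mulVec, dotProduct_mulVec_of_orthogonal hV, h2, dotProduct,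
      dotProduct, Finset.mul_sum]
    refine Finset.sum_le_sum fun i _ => ?_
    rw [mulVec_diagonal]
    have h3 : d i ^ 2 ≤ c ^ 2 := sq_le_sq' (neg_le_of_abs_le (hd i).le) (le_of_abs_le (hd i).le)
    nlinarith [mul_self_nonneg ((Vᵀ *ᵥ v) i)]
  obtain ⟨i, hi⟩ := this
  calc c ^ (2 * q) ≤ |d i| ^ (2 * q) := pow_le_pow_left₀ hc hi _
    _ = d i ^ (2 * q) := (even_two_mul q).pow_abs _
    _ ≤ ∑ i, d i ^ (2 * q) := Finset.single_le_sum (f := fun i => d i ^ (2 * q))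
        (fun i _ => (even_two_mul q).pow_nonneg _) (Finset.mem_univ i)

theorem IsContraction.mul {A B : Mat m} (hA : IsContraction 1 A) (hB : IsContraction 1 B) :
    IsContraction 1 (A * B) := fun v => by
  have h1 := hA (B *ᵥ v)
  have h2 := hB v
  rw [← mulVec_mulVec]
  linarith

theorem isContraction_one : IsContraction 1 (1 : Mat m) := fun v => by simp

theorem IsContraction.trace_le {B : Mat m} (hB : IsContraction 1 B) :
    B.trace ≤ (m : ℝ) + 1 := by
  have h : ∀ i ∈ Finset.univ, B i i ≤ 1 := fun i _ => by
    have h1 := hB (Pi.single i 1)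
    have h2 : B i i * B i i ≤ (B *ᵥ Pi.single i 1) ⬝ᵥ (B *ᵥ Pi.single i 1) := by
      simp only [mulVec_single_one]
      exact Finset.single_le_sum (f := fun j => B j i * B j i)
        (fun j _ => mul_self_nonneg _) (Finset.mem_univ i)
    have h3 : (Pi.single i 1 : Fin (m + 1) → ℝ) ⬝ᵥ Pi.single i 1 = 1 := by simp
    rw [h3] at h1
    nlinarith
  simpa [Matrix.trace] using Finset.sum_le_card_nsmul _ _ 1 h

end EvenPowers

/-! ### Gaussian matrix series -/

section GaussianSeries

variable {m : ℕ} {Ω ι : Type*} [MeasurableSpace Ω] {μ : Measure Ω} [Fintype ι]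
  {g : ι → Ω → ℝ} {v : ℝ≥0}

/-- Odd moments vanish by symmetry. This sign is what permits bounding each trace coefficient
separately in a moment expansion. -/
theorem integral_pow_gaussianReal_nonneg (v : ℝ≥0) (k : ℕ) :
    0 ≤ ∫ x, x ^ k ∂(gaussianReal 0 v) := by
  rcases Nat.even_or_odd k with hk | hk
  · exact integral_nonneg fun x => hk.pow_nonneg x
  · have h : ∫ x, x ^ k ∂(gaussianReal 0 v) = ∫ x, (-x) ^ k ∂(gaussianReal 0 v) := by
      have h0 : (gaussianReal 0 v).map (fun x => -x) = gaussianReal 0 v := by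
        rw [gaussianReal_map_neg, neg_zero]
      conv_lhs => rw [← h0]
      rw [integral_map (by fun_prop) (by fun_prop)]
    simp only [hk.neg_pow, integral_neg] at h
    linarith

theorem integrable_pow_gaussianReal (v : ℝ≥0) (k : ℕ) :
    Integrable (fun x => x ^ k) (gaussianReal 0 v) := by
  have h : MemLp id (k : ℝ≥0∞) (gaussianReal 0 v) := memLp_id_gaussianReal' _ (by simp)
  rcases eq_or_ne k 0 with rfl | hk
  · simp
  · refine (integrable_norm_iff (by fun_prop)).1 ?_
    simpa using h.integrable_norm_pow hk

theorem integral_prod_pow_nonneg (hm : ∀ t, Measurable (g t))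
    (hg : ∀ t, μ.map (g t) = gaussianReal 0 v) (hi : iIndepFun g μ) (c : ι → ℕ) :
    0 ≤ ∫ ω, ∏ t, g t ω ^ c t ∂μ := by
  rw [hi.integral_fun_prod_comp (f := fun t (x : ℝ) => x ^ c t) (fun t => (hm t).aemeasurable)
    (fun t => by fun_prop)]
  refine Finset.prod_nonneg fun t _ => ?_
  have := integral_map (μ := μ) (hm t).aemeasurable
    (f := fun x : ℝ => x ^ c t) (by fun_prop)
  rw [← this, hg]
  exact integral_pow_gaussianReal_nonneg v _

variable [IsProbabilityMeasure μ]

theorem integrable_prod_pow (hm : ∀ t, Measurable (g t)) (hg : ∀ t, μ.map (g t) = gaussianReal 0 v)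
    (hi : iIndepFun g μ) (c : ι → ℕ) : Integrable (fun ω => ∏ t, g t ω ^ c t) μ := by
  have h := (iIndepFun_iff_map_fun_eq_pi_map fun t => (hm t).aemeasurable).1 hi
  have h1 : Integrable (fun x : ι → ℝ => ∏ t, x t ^ c t) (Measure.pi fun t => μ.map (g t)) := by
    refine Integrable.fintype_prod (f := fun t (x : ℝ) => x ^ c t) fun t => ?_
    rw [hg]
    exact integrable_pow_gaussianReal v _
  rw [← h] at h1
  exact h1.comp_measurable (measurable_pi_lambda _ hm)

theorem prod_pow_add_single [DecidableEq ι] (x : ι → ℝ) (c : ι → ℕ) (t : ι) :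
    ∏ i, x i ^ (c + Pi.single t 1 : ι → ℕ) i = (∏ i, x i ^ c i) * x t := by
  simp only [Pi.add_apply, pow_add, Finset.prod_mul_distrib]
  congr 1
  rw [Finset.prod_eq_single t] <;> simp +contextual

/-- The mixed moments of a Gaussian series with contractive matrix coefficients are dominated by
those of the scalar series. -/
theorem integral_trace_mul_pow_le (hm : ∀ t, Measurable (g t))
    (hg : ∀ t, μ.map (g t) = gaussianReal 0 v) (hi : iIndepFun g μ) {A : ι → Mat m}
    (hA : ∀ t, IsContraction 1 (A t)) (k : ℕ) :
    ∀ (c : ι → ℕ) {B : Mat m}, IsContraction 1 B →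
      Integrable (fun ω => (∏ t, g t ω ^ c t) * (B * (∑ t, g t ω • A t) ^ k).trace) μ ∧
      Integrable (fun ω => (∏ t, g t ω ^ c t) * (∑ t, g t ω) ^ k) μ ∧
      ∫ ω, (∏ t, g t ω ^ c t) * (B * (∑ t, g t ω • A t) ^ k).trace ∂μ ≤
        ((m : ℝ) + 1) * ∫ ω, (∏ t, g t ω ^ c t) * (∑ t, g t ω) ^ k ∂μ := by
  classical
  -- Each step peels off one factor of the power, moving `A s` into `B` and `g s` into the monomial;
  -- hence the generalization over `c` and `B`.
  induction k with
  | zero =>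
    intro c B hB
    have h := integrable_prod_pow hm hg hi c
    simp only [pow_zero, mul_one]
    refine ⟨h.mul_const _, h, ?_⟩
    rw [integral_mul_const, mul_comm]
    exact mul_le_mul_of_nonneg_right hB.trace_le (integral_prod_pow_nonneg hm hg hi c)
  | succ k ih =>
    intro c B hB
    have e1 (ω : Ω) : (∏ t, g t ω ^ c t) * (B * (∑ t, g t ω • A t) ^ (k + 1)).trace
        = ∑ s, (∏ t, g t ω ^ (c + Pi.single s 1 : ι → ℕ) t) *
            (B * A s * (∑ t, g t ω • A t) ^ k).trace := by
      rw [pow_succ', Finset.sum_mul, Matrix.mul_sum, Matrix.trace_sum, Finset.mul_sum]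
      refine Finset.sum_congr rfl fun s _ => ?_
      rw [prod_pow_add_single (fun t => g t ω), Matrix.smul_mul, Matrix.mul_smul, trace_smul,
        smul_eq_mul, Matrix.mul_assoc, mul_assoc]
    have e2 (ω : Ω) : (∏ t, g t ω ^ c t) * (∑ t, g t ω) ^ (k + 1)
        = ∑ s, (∏ t, g t ω ^ (c + Pi.single s 1 : ι → ℕ) t) * (∑ t, g t ω) ^ k := by
      rw [pow_succ', Finset.sum_mul, Finset.mul_sum]
      refine Finset.sum_congr rfl fun s _ => ?_
      rw [prod_pow_add_single (fun t => g t ω), mul_assoc]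
    have h := fun s => ih (c + Pi.single s 1) (hB.mul (hA s))
    simp only [e1, e2]
    refine ⟨integrable_finsetSum _ fun s _ => (h s).1,
      integrable_finsetSum _ fun s _ => (h s).2.1, ?_⟩
    rw [integral_finsetSum _ fun s _ => (h s).1, integral_finsetSum _ fun s _ => (h s).2.1,
      Finset.mul_sum]
    exact Finset.sum_le_sum fun s _ => (h s).2.2

theorem integral_cosh_mul_sum (hm : ∀ t, Measurable (g t))
    (hg : ∀ t, μ.map (g t) = gaussianReal 0 v) (hi : iIndepFun g μ) (θ : ℝ) :
    Integrable (fun ω => Real.cosh (θ * ∑ t, g t ω)) μ ∧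
      ∫ ω, Real.cosh (θ * ∑ t, g t ω) ∂μ = Real.exp (Fintype.card ι * (v * θ ^ 2 / 2)) := by
  have hint (r : ℝ) : Integrable (fun ω => Real.exp (r * ∑ t, g t ω)) μ := by
    have := hi.integrable_exp_mul_sum hm (s := Finset.univ) (t := r) fun t _ => by
      have h := integrable_exp_mul_gaussianReal (μ := 0) (v := v) r
      rw [← hg t] at h
      exact h.comp_measurable (hm t)
    simpa using this
  have hval (r : ℝ) : ∫ ω, Real.exp (r * ∑ t, g t ω) ∂μ
      = Real.exp (Fintype.card ι * (v * r ^ 2 / 2)) := by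
    have := hi.mgf_sum hm Finset.univ (t := r)
    simp only [mgf_gaussianReal (hg _), zero_mul, zero_add, Finset.prod_const, Finset.card_univ,
      ← Real.exp_nat_mul] at this
    rw [← this]
    simp [mgf]
  have e (ω : Ω) : Real.cosh (θ * ∑ t, g t ω) =
      (Real.exp (θ * ∑ t, g t ω) + Real.exp ((-θ) * ∑ t, g t ω)) / 2 := by
    rw [Real.cosh_eq, neg_mul]
  simp only [e]
  refine ⟨((hint _).add (hint _)).div_const 2, ?_⟩
  rw [integral_div, integral_add (hint _) (hint _), hval, hval, neg_sq]
  ring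

/-- Markov's inequality for the trace of every even power, weighted by `θ^(2q)/(2q)!` and summed.
The event does not depend on `q`, so the left sides add up to a `cosh` as well. -/
theorem measureReal_mul_cosh_le (hm : ∀ t, Measurable (g t))
    (hg : ∀ t, μ.map (g t) = gaussianReal 0 v) (hi : iIndepFun g μ) {A : ι → Mat m}
    (hA : ∀ t, IsContraction 1 (A t)) (hs : ∀ t, (A t).IsSymm) {u : ℝ} (hu : 0 ≤ u) (θ : ℝ) :
    μ.real {ω | ¬ IsContraction u (∑ t, g t ω • A t)} * Real.cosh (θ * u) ≤
      ((m : ℝ) + 1) * Real.exp (Fintype.card ι * (v * θ ^ 2 / 2)) := by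
  set p := μ.real {ω | ¬ IsContraction u (∑ t, g t ω • A t)} with hp
  have hsymm (ω : Ω) : (∑ t, g t ω • A t).IsSymm := by
    rw [IsSymm, transpose_sum]
    exact Finset.sum_congr rfl fun t _ => by rw [transpose_smul, hs t]
  have hcoef (q : ℕ) : 0 ≤ θ ^ (2 * q) / (2 * q).factorial :=
    div_nonneg ((even_two_mul q).pow_nonneg θ) (Nat.cast_nonneg _)
  have hmom (q : ℕ) : Integrable (fun ω => (∑ t, g t ω) ^ (2 * q)) μ ∧
      p * u ^ (2 * q) ≤ ((m : ℝ) + 1) * ∫ ω, (∑ t, g t ω) ^ (2 * q) ∂μ := by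
    have h := integral_trace_mul_pow_le hm hg hi hA (2 * q) 0 isContraction_one
    simp only [Pi.zero_apply, pow_zero, Finset.prod_const_one, one_mul] at h
    refine ⟨h.2.1, le_trans ?_ h.2.2⟩
    have h1 := mul_meas_ge_le_integral_of_nonneg
      (Filter.Eventually.of_forall fun ω => trace_pow_two_mul_nonneg (hsymm ω) q) h.1 (u ^ (2 * q))
    refine le_trans ?_ h1
    rw [mul_comm]
    refine mul_le_mul_of_nonneg_left (measureReal_mono fun ω hω => ?_) (by positivity)
    exact pow_le_trace_pow (hsymm ω) hu hω q
  obtain ⟨hci, hcv⟩ := integral_cosh_mul_sum hm hg hi θ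
  rw [← hcv]
  refine le_of_tendsto' ((Real.hasSum_cosh (θ * u)).tendsto_sum_nat.const_mul p) fun Q => ?_
  have hint : ∀ q ∈ Finset.range Q,
      Integrable (fun ω => θ ^ (2 * q) / (2 * q).factorial * (∑ t, g t ω) ^ (2 * q)) μ :=
    fun q _ => (hmom q).1.const_mul _
  calc p * ∑ q ∈ Finset.range Q, (θ * u) ^ (2 * q) / (2 * q).factorial
      = ∑ q ∈ Finset.range Q, θ ^ (2 * q) / (2 * q).factorial * (p * u ^ (2 * q)) := by
        rw [Finset.mul_sum]
        refine Finset.sum_congr rfl fun q _ => ?_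
        rw [mul_pow]
        ring
    _ ≤ ∑ q ∈ Finset.range Q, θ ^ (2 * q) / (2 * q).factorial *
          (((m : ℝ) + 1) * ∫ ω, (∑ t, g t ω) ^ (2 * q) ∂μ) :=
        Finset.sum_le_sum fun q _ => mul_le_mul_of_nonneg_left (hmom q).2 (hcoef q)
    _ = ((m : ℝ) + 1) * ∫ ω, ∑ q ∈ Finset.range Q,
          θ ^ (2 * q) / (2 * q).factorial * (∑ t, g t ω) ^ (2 * q) ∂μ := by
        rw [integral_finsetSum _ hint, Finset.mul_sum]
        refine Finset.sum_congr rfl fun q _ => ?_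
        rw [integral_const_mul]
        ring
    _ ≤ ((m : ℝ) + 1) * ∫ ω, Real.cosh (θ * ∑ t, g t ω) ∂μ := by
        refine mul_le_mul_of_nonneg_left ?_ (by positivity)
        refine integral_mono (integrable_finsetSum _ hint) hci fun ω => ?_
        have hsum := Real.hasSum_cosh (θ * ∑ t, g t ω)
        have h := sum_le_hasSum (Finset.range Q) (fun q _ => div_nonneg
          ((even_two_mul q).pow_nonneg (θ * ∑ t, g t ω)) (Nat.cast_nonneg _)) hsum
        refine le_trans (le_of_eq ?_) h
        refine Finset.sum_congr rfl fun q _ => ?_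
        rw [mul_pow]
        ring

/-- Tail bound for the spectral norm of a Gaussian matrix series. -/
theorem measureReal_not_isContraction_le (hm : ∀ t, Measurable (g t))
    (hg : ∀ t, μ.map (g t) = gaussianReal 0 v) (hi : iIndepFun g μ) {A : ι → Mat m}
    (hA : ∀ t, IsContraction 1 (A t)) (hs : ∀ t, (A t).IsSymm) {u w : ℝ} (hu : 0 ≤ u)
    (hw : 0 < w) (hv : Fintype.card ι * (v : ℝ) ≤ w) :
    μ.real {ω | ¬ IsContraction u (∑ t, g t ω • A t)} ≤
      2 * ((m : ℝ) + 1) * Real.exp (-(u ^ 2 / (2 * w))) := by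
  -- `θ = u / w` minimizes `w θ²/2 - θ u`; bounding `cosh x` below by `exp x / 2` costs the factor
  -- `2`.
  have h := measureReal_mul_cosh_le hm hg hi hA hs hu (u / w)
  set p := μ.real {ω | ¬ IsContraction u (∑ t, g t ω • A t)} with hp
  have hp0 : 0 ≤ p := measureReal_nonneg
  have h1 : Real.exp (u / w * u) / 2 ≤ Real.cosh (u / w * u) := by
    rw [Real.cosh_eq]
    linarith [Real.exp_pos (-(u / w * u))]
  have h2 : Real.exp (Fintype.card ι * (v * (u / w) ^ 2 / 2)) ≤ Real.exp (u ^ 2 / (2 * w)) := by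
    rw [Real.exp_le_exp]
    calc Fintype.card ι * (v * (u / w) ^ 2 / 2) = Fintype.card ι * (v : ℝ) * ((u / w) ^ 2 / 2) := by
          ring
      _ ≤ w * ((u / w) ^ 2 / 2) := mul_le_mul_of_nonneg_right hv (by positivity)
      _ = u ^ 2 / (2 * w) := by field_simp
  have h3 : Real.exp (u / w * u) = Real.exp (u ^ 2 / (2 * w)) * Real.exp (u ^ 2 / (2 * w)) := by
    rw [← Real.exp_add]
    congr 1
    field_simp
    ring
  have h4 : p * (Real.exp (u ^ 2 / (2 * w)) * Real.exp (u ^ 2 / (2 * w)) / 2) ≤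
      ((m : ℝ) + 1) * Real.exp (u ^ 2 / (2 * w)) := by
    rw [← h3]
    exact (mul_le_mul_of_nonneg_left h1 hp0).trans
      (h.trans (mul_le_mul_of_nonneg_left h2 (by positivity)))
  have h5 := Real.exp_pos (u ^ 2 / (2 * w))
  rw [Real.exp_neg, ← div_eq_mul_inv, le_div_iff₀ h5]
  have h6 : p * Real.exp (u ^ 2 / (2 * w)) * Real.exp (u ^ 2 / (2 * w)) ≤
      2 * ((m : ℝ) + 1) * Real.exp (u ^ 2 / (2 * w)) := by linarith
  exact le_of_mul_le_mul_right h6 h5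

end GaussianSeries

/-! ### Conditioning on a finitely valued parameter independent of the noise -/

section Conditioning

variable {Ω U E α : Type*} [MeasurableSpace Ω] [MeasurableSpace U] [MeasurableSpace E]
  {μ : Measure Ω} [IsProbabilityMeasure μ]

/-- A bound on the probability of an event that depends on independent noise and on a finitely
valued parameter can be checked for each value of the parameter. -/
theorem measure_le_of_forall_parameter [Fintype α] {seed : Ω → U} {X : Ω → E}
    (hseed : Measurable seed) (hind : IndepFun seed X μ)
    {e : U → α} (he : ∀ a, MeasurableSet (e ⁻¹' {a})) {S : α → Set E}
    (hS : ∀ a, MeasurableSet (S a)) {ε : ℝ≥0∞} (h : ∀ a, μ (X ⁻¹' S a) ≤ ε) :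
    μ {ω | X ω ∈ S (e (seed ω))} ≤ ε := by
  -- Splitting by the value of the parameter fixes the noise event in each piece, where independence
  -- factors the probability.
  have hsub : {ω | X ω ∈ S (e (seed ω))} ⊆ ⋃ a, seed ⁻¹' (e ⁻¹' {a}) ∩ X ⁻¹' S a :=
    fun ω hω => Set.mem_iUnion.2 ⟨e (seed ω), rfl, hω⟩
  calc μ {ω | X ω ∈ S (e (seed ω))} ≤ ∑ a, μ (seed ⁻¹' (e ⁻¹' {a}) ∩ X ⁻¹' S a) :=
        (measure_mono hsub).trans (measure_iUnion_fintype_le _ _)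
    _ = ∑ a, μ (seed ⁻¹' (e ⁻¹' {a})) * μ (X ⁻¹' S a) :=
        Finset.sum_congr rfl fun a _ =>
          hind.measure_inter_preimage_eq_mul _ _ (he a) (hS a)
    _ ≤ ∑ a, μ (seed ⁻¹' (e ⁻¹' {a})) * ε := by gcongr; exact h _
    _ = μ ((e ∘ seed) ⁻¹' (Finset.univ : Finset α)) * ε := by
        rw [← Finset.sum_mul, ← sum_measure_preimage_singleton]
        · rfl
        · exact fun a _ => hseed (he a)
    _ ≤ ε := by simp

end Conditioning

/-! ### The curvature is at most of order `1 / |V|` -/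

section Curvature

variable {m T₁ : ℕ}

/-- The coordinate vector of `i` projected to the complement of the all-ones vector. -/
def centeredSingle (m : ℕ) (i : Fin (m + 1)) : Fin (m + 1) → ℝ :=
  Pi.single i 1 - fun _ => ((m : ℝ) + 1)⁻¹

theorem centeredSingle_dotProduct (i : Fin (m + 1)) (y : Fin (m + 1) → ℝ) :
    centeredSingle m i ⬝ᵥ y = y i - ((m : ℝ) + 1)⁻¹ * ∑ j, y j := by
  rw [centeredSingle, sub_dotProduct, single_one_dotProduct, dotProduct, Finset.mul_sum]

/-- Parseval identity: the projected coordinate vectors form a tight frame of the complement of the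
all-ones vector. -/
theorem sum_centeredSingle_dotProduct_sq (y : Fin (m + 1) → ℝ) :
    ∑ i, (centeredSingle m i ⬝ᵥ y) ^ 2 = y ⬝ᵥ y - ((m : ℝ) + 1)⁻¹ * (∑ j, y j) ^ 2 := by
  have h0 : (m : ℝ) + 1 ≠ 0 := by positivity
  set c := ((m : ℝ) + 1)⁻¹ * ∑ j, y j with hc
  have h1 : ∑ j, y j = ((m : ℝ) + 1) * c := by rw [hc, mul_inv_cancel_left₀ h0]
  calc ∑ i, (centeredSingle m i ⬝ᵥ y) ^ 2 = ∑ i, (y i * y i - 2 * c * y i + c ^ 2) :=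
        Finset.sum_congr rfl fun i _ => by rw [centeredSingle_dotProduct]; ring
    _ = y ⬝ᵥ y - 2 * c * ∑ j, y j + ((m : ℝ) + 1) * c ^ 2 := by
        rw [Finset.sum_add_distrib, Finset.sum_sub_distrib, ← Finset.mul_sum]
        simp [dotProduct]
    _ = _ := by
        rw [h1]
        field_simp
        ring

theorem sum_centeredSingle_dotProduct_self :
    ∑ i, centeredSingle m i ⬝ᵥ centeredSingle m i = (m : ℝ) := by
  have h0 (i : Fin (m + 1)) : ∑ j, centeredSingle m i j = 0 := by
    have h := centeredSingle_dotProduct i (fun _ => (1 : ℝ))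
    have h1 : (m : ℝ) + 1 ≠ 0 := by positivity
    simpa [dotProduct, inv_mul_cancel₀ h1] using h
  simp only [centeredSingle_dotProduct, h0, mul_zero, sub_zero]
  have h1 : (m : ℝ) + 1 ≠ 0 := by positivity
  simp [centeredSingle, Finset.sum_sub_distrib]
  field_simp
  ring

theorem IsAdmissible.sub {A B : Mat m} (hA : IsAdmissible A) (hB : IsAdmissible B) :
    IsAdmissible (A - B) := by
  obtain ⟨hA, a, ha⟩ := hA
  obtain ⟨hB, b, hb⟩ := hB
  exact ⟨hA.sub hB, a - b, by rw [sub_mulVec, ha, hb, sub_smul]⟩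

/-- RSC is tested on `s aᵀ + a sᵀ` with `a` a projected coordinate vector: orthogonality of `a` and
`s` to the all-ones vector makes it admissible, and it lies in the cone with `B = 0`. Summed over
the coordinates, the frame identity bounds the design side by `2 ‖s‖²`, while the squared lengths of
the `a` add up to `m`. -/
theorem RSC.curvature_le {s : Fin (m + 1) → ℝ} (hs : 0 < s ⬝ᵥ s) (hs0 : ∑ v, s v = 0)
    {X : Fin T₁ → Mat m} (hX : ∀ t, IsContraction 1 (X t)) (hsymm : ∀ t, (X t).IsSymm)
    {κ τsq : ℝ} (hτ : 0 ≤ τsq) (h : RSC s X κ τsq) : (κ - 4 * τsq) * m ≤ 2 := by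
  have h1 (i : Fin (m + 1)) :
      (κ - 4 * τsq) * (s ⬝ᵥ s) * (centeredSingle m i ⬝ᵥ centeredSingle m i) ≤ 0 ∨
      (κ - 4 * τsq) * (s ⬝ᵥ s) * (centeredSingle m i ⬝ᵥ centeredSingle m i) ≤
      1 / (2 * (T₁ : ℝ)) * ∑ t, 4 * (centeredSingle m i ⬝ᵥ X t *ᵥ s) ^ 2 := by
    set a := centeredSingle m i with ha
    have ha1 : a ⬝ᵥ (fun _ => 1) = 0 := by
      have h1 : (m : ℝ) + 1 ≠ 0 := by positivity
      simp [ha, centeredSingle_dotProduct, inv_mul_cancel₀ h1]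
    have hs1 : s ⬝ᵥ (fun _ => 1) = 0 := by simpa [dotProduct] using hs0
    have hadm : IsAdmissible (vecMulVec s a + vecMulVec a s) := by
      refine ⟨?_, 0, ?_⟩
      · rw [IsSymm, transpose_add, transpose_vecMulVec, transpose_vecMulVec]
        exact add_comm _ _
      · rw [add_mulVec, vecMulVec_mulVec, vecMulVec_mulVec, ha1, hs1]
        simp
    have hcone : InCone s (vecMulVec s a + vecMulVec a s) :=
      ⟨a, a, 0, zero_mulVec _, vecMul_zero _, (add_zero _).symm, by
        rw [nucNorm_zero]
        exact mul_nonneg (by norm_num) (nucNorm_nonneg _)⟩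
    have h2 := h _ hadm hcone
    have hin (t : Fin T₁) :
        traceInner (X t) (vecMulVec s a + vecMulVec a s) ^ 2 = 4 * (a ⬝ᵥ X t *ᵥ s) ^ 2 := by
      have : s ⬝ᵥ X t *ᵥ a = a ⬝ᵥ X t *ᵥ s := by
        rw [dotProduct_mulVec, ← mulVec_transpose, hsymm t, dotProduct_comm]
      rw [traceInner_add_right, traceInner_vecMulVec, traceInner_vecMulVec, this]
      ring
    simp only [hin] at h2
    have hfrob : 2 * ((s ⬝ᵥ s) * (a ⬝ᵥ a)) ≤ frobSq (vecMulVec s a + vecMulVec a s) := by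
      rw [frobSq_vecMulVec_add, dotProduct_comm a s]
      nlinarith [mul_self_nonneg (s ⬝ᵥ a)]
    have hnuc : nucNorm (vecMulVec s a + vecMulVec a s) ^ 2 ≤ 4 * ((s ⬝ᵥ s) * (a ⬝ᵥ a)) := by
      have h3 := (nucNorm_add_le (vecMulVec s a) (vecMulVec a s)).trans
        (add_le_add (nucNorm_vecMulVec_le s a) (nucNorm_vecMulVec_le a s))
      refine (pow_le_pow_left₀ (nucNorm_nonneg _) h3 2).trans (le_of_eq ?_)
      have e1 := Real.sq_sqrt hs.le
      have e2 := Real.sq_sqrt (dotProduct_self_nonneg' a)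
      calc _ = 4 * (√(s ⬝ᵥ s) ^ 2 * √(a ⬝ᵥ a) ^ 2) := by ring
        _ = _ := by rw [e1, e2]
    rcases le_or_gt κ 0 with hκ | hκ
    · left
      exact mul_nonpos_of_nonpos_of_nonneg (mul_nonpos_of_nonpos_of_nonneg (by linarith) hs.le)
        (dotProduct_self_nonneg' a)
    · right
      refine le_trans ?_ h2
      nlinarith [mul_le_mul_of_nonneg_left hfrob hκ.le, mul_le_mul_of_nonneg_left hnuc hτ]
  have h2 (i : Fin (m + 1)) :
      (κ - 4 * τsq) * (s ⬝ᵥ s) * (centeredSingle m i ⬝ᵥ centeredSingle m i) ≤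
      1 / (2 * (T₁ : ℝ)) * ∑ t, 4 * (centeredSingle m i ⬝ᵥ X t *ᵥ s) ^ 2 :=
    (h1 i).elim (fun h => h.trans (by positivity)) id
  have h3 := Finset.sum_le_sum fun i (_ : i ∈ Finset.univ) => h2 i
  rw [← Finset.mul_sum, sum_centeredSingle_dotProduct_self, ← Finset.mul_sum,
    Finset.sum_comm] at h3
  have h4 : ∑ t, ∑ i, 4 * (centeredSingle m i ⬝ᵥ X t *ᵥ s) ^ 2 ≤ T₁ * (4 * (s ⬝ᵥ s)) := by
    have : ∀ t ∈ Finset.univ, ∑ i, 4 * (centeredSingle m i ⬝ᵥ X t *ᵥ s) ^ 2 ≤ 4 * (s ⬝ᵥ s) := by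
      intro t _
      rw [← Finset.mul_sum, sum_centeredSingle_dotProduct_sq]
      have e1 := hX t s
      have e2 : 0 ≤ ((m : ℝ) + 1)⁻¹ * (∑ j, (X t *ᵥ s) j) ^ 2 := by positivity
      linarith
    simpa using Finset.sum_le_card_nsmul _ _ _ this
  have h5 : 1 / (2 * (T₁ : ℝ)) * (T₁ * (4 * (s ⬝ᵥ s))) ≤ 2 * (s ⬝ᵥ s) := by
    rcases Nat.eq_zero_or_pos T₁ with h | h
    · simp [h, hs.le]
    · have : (0 : ℝ) < T₁ := by exact_mod_cast h
      apply le_of_eq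
      field_simp
      ring
  have h6 : 1 / (2 * (T₁ : ℝ)) * ∑ t, ∑ i, 4 * (centeredSingle m i ⬝ᵥ X t *ᵥ s) ^ 2 ≤
      1 / (2 * (T₁ : ℝ)) * (T₁ * (4 * (s ⬝ᵥ s))) :=
    mul_le_mul_of_nonneg_left h4 (by positivity)
  have h7 : (κ - 4 * τsq) * m * (s ⬝ᵥ s) ≤ 2 * (s ⬝ᵥ s) := by linarith
  exact le_of_mul_le_mul_right h7 hs

end Curvature

/-! ### The estimator -/

section Estimator

variable {m T₁ : ℕ}

/-- Splitting of a symmetric matrix along `s aᵀ + b sᵀ` and the matrices vanishing on `s`. -/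
theorem exists_cone_decomposition {s : Fin (m + 1) → ℝ} (hs : 0 < s ⬝ᵥ s) {D : Mat m}
    (hD : D.IsSymm) : ∃ (a b : Fin (m + 1) → ℝ) (B : Mat m), B *ᵥ s = 0 ∧ s ᵥ* B = 0 ∧
      s ⬝ᵥ b = 0 ∧ D = (vecMulVec s a + vecMulVec b s) + B := by
  set q := s ⬝ᵥ s with hq
  -- Chosen so that `B` is `D` compressed on both sides to the complement of `s`; the `s sᵀ`
  -- component goes entirely into `s aᵀ`, which makes `b ⊥ s`.
  set a := q⁻¹ • (D *ᵥ s) with ha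
  set r := s ⬝ᵥ a with hr
  set b := a - (q⁻¹ * r) • s with hb
  have hqa : q • a = D *ᵥ s := by rw [ha, smul_inv_smul₀ hs.ne']
  have hqb : q • b + r • s = D *ᵥ s := by
    rw [hb, smul_sub, hqa, smul_smul, mul_inv_cancel_left₀ hs.ne', sub_add_cancel]
  have hsb : s ⬝ᵥ b = 0 := by
    rw [hb, dotProduct_sub, ← hr, dotProduct_smul, ← hq, smul_eq_mul]
    field_simp
    ring
  refine ⟨a, b, D - (vecMulVec s a + vecMulVec b s), ?_, ?_, hsb, by abel⟩
  · rw [sub_mulVec, add_mulVec, vecMulVec_mulVec, vecMulVec_mulVec, ← hqb, dotProduct_comm a s,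
      ← hr, ← hq]
    simp only [op_smul_eq_smul]
    abel
  · rw [vecMul_sub, vecMul_add, vecMul_vecMulVec, vecMul_vecMulVec, ← hq, hsb, hqa,
      ← mulVec_transpose, hD]
    simp

/-- Comparing the objective at `Θ` and at `s sᵀ`, with noise at most `l / 2` in dual norm, bounds
the design energy by `l (3/2 ‖M‖ - 1/2 ‖B‖)` in nuclear norms. Nonnegativity of the energy gives the
cone condition; RSC then bounds the error. -/
theorem RSC.frobSq_sub_le {s : Fin (m + 1) → ℝ} (hs : 0 < s ⬝ᵥ s) {X : Fin T₁ → Mat m}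
    {η : Fin T₁ → ℝ} {Θ : Mat m} {κ τsq l : ℝ} (hκ : 0 < κ) (hl : 0 < l) (hT : 0 < T₁)
    (hτ0 : 0 ≤ τsq) (hτ : 128 * τsq ≤ κ) (hRSC : RSC s X κ τsq)
    (hadm : IsAdmissible (Θ - vecMulVec s s))
    (hnoise : IsContraction (T₁ * (l / 2)) (∑ t, η t • X t))
    (hmin : objective l X (fun t => traceInner (vecMulVec s s) (X t) + η t) Θ ≤
      objective l X (fun t => traceInner (vecMulVec s s) (X t) + η t) (vecMulVec s s)) :
    frobSq (Θ - vecMulVec s s) ≤ 72 * (l ^ 2 / κ ^ 2) := by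
  set D := Θ - vecMulVec s s with hD
  have hT' : (0 : ℝ) < T₁ := by exact_mod_cast hT
  obtain ⟨a, b, B, hB1, hB2, hsb, hdec⟩ := exists_cone_decomposition hs hadm.1
  set M := vecMulVec s a + vecMulVec b s with hM
  have hbasic : 1 / (2 * (T₁ : ℝ)) * ∑ t, traceInner (X t) D ^ 2 ≤
      l / 2 * nucNorm D + l * (nucNorm (vecMulVec s s) - nucNorm Θ) := by
    have e1 (t : Fin T₁) : (traceInner (vecMulVec s s) (X t) + η t - traceInner (X t) Θ) ^ 2
        = η t ^ 2 - 2 * (η t * traceInner (X t) D) + traceInner (X t) D ^ 2 := by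
      rw [hD, traceInner_sub_right, traceInner_comm (vecMulVec s s)]
      ring
    have e2 (t : Fin T₁) :
        (traceInner (vecMulVec s s) (X t) + η t - traceInner (X t) (vecMulVec s s)) ^ 2
        = η t ^ 2 := by
      rw [traceInner_comm (vecMulVec s s)]
      ring
    rw [objective, objective] at hmin
    simp only [e1, e2, Finset.sum_add_distrib, Finset.sum_sub_distrib, ← Finset.mul_sum] at hmin
    have e3 : ∑ t, η t * traceInner (X t) D ≤ T₁ * (l / 2) * nucNorm D := by
      have := traceInner_le_nucNorm (by positivity) hnoise D
      rwa [traceInner_sum_left, Finset.sum_congr rfl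
        fun t _ => traceInner_smul_left (η t) (X t) D] at this
    have e4 : 1 / (2 * (T₁ : ℝ)) * (2 * ∑ t, η t * traceInner (X t) D) ≤ l / 2 * nucNorm D := by
      calc _ ≤ 1 / (2 * (T₁ : ℝ)) * (2 * (T₁ * (l / 2) * nucNorm D)) := by gcongr
        _ = _ := by field_simp
    rw [mul_add, mul_sub] at hmin
    linarith
  have hdecomp : nucNorm (vecMulVec s s) - nucNorm Θ ≤ nucNorm M - nucNorm B := by
    have e1 := le_nucNorm_add_of_orthogonal hs hB1 hB2
    have e2 : nucNorm (vecMulVec s s) ≤ s ⬝ᵥ s := by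
      have := nucNorm_vecMulVec_le s s
      rwa [Real.mul_self_sqrt hs.le] at this
    have e3 := nucNorm_add_le Θ (-M)
    have e4 : vecMulVec s s + B = Θ + -M := by
      have : Θ = vecMulVec s s + (M + B) := by rw [← hdec, hD]; abel
      rw [this]
      abel
    rw [nucNorm_neg, ← e4] at e3
    linarith
  have htri : nucNorm D ≤ nucNorm M + nucNorm B := hdec ▸ nucNorm_add_le M B
  have hM0 := nucNorm_nonneg M
  have hB0 := nucNorm_nonneg B
  have hD0 := nucNorm_nonneg D
  have hmain : 1 / (2 * (T₁ : ℝ)) * ∑ t, traceInner (X t) D ^ 2 ≤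
      l * (3 / 2 * nucNorm M - 1 / 2 * nucNorm B) := by
    have e1 := mul_le_mul_of_nonneg_left hdecomp hl.le
    have e2 := mul_le_mul_of_nonneg_left htri (by positivity : 0 ≤ l / 2)
    linarith
  have hcone : nucNorm B ≤ 3 * nucNorm M := by
    have e1 : 0 ≤ 1 / (2 * (T₁ : ℝ)) * ∑ t, traceInner (X t) D ^ 2 := by positivity
    have e2 := nonneg_of_mul_nonneg_right (e1.trans hmain) hl
    linarith
  have hr := hRSC D hadm ⟨a, b, B, hB1, hB2, hdec, hcone⟩
  have hMF : nucNorm M ^ 2 ≤ 2 * frobSq M := nucNorm_sq_le_two_mul_frobSq a hsb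
  have hF : frobSq M ≤ frobSq D := by
    have e1 : traceInner M B = 0 := by
      rw [hM, traceInner_comm, traceInner_add_right, traceInner_vecMulVec, traceInner_vecMulVec,
        hB1, dotProduct_zero, dotProduct_mulVec, hB2, zero_dotProduct, add_zero]
    have e2 := frobSq_nonneg B
    rw [hdec, frobSq_add M B, e1]
    linarith
  set F := frobSq D with hFdef
  have hF0 : 0 ≤ F := frobSq_nonneg D
  -- On the cone `‖D‖_nuc ≤ 4 ‖M‖_nuc`, and `4² · 2 = 32`. With `128 τ² ≤ κ` the tolerance then uses
  -- up only half of the curvature term.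
  have e1 : nucNorm D ^ 2 ≤ 32 * F := by
    have : nucNorm D ^ 2 ≤ (4 * nucNorm M) ^ 2 := pow_le_pow_left₀ hD0 (by linarith) 2
    linarith [mul_pow 4 (nucNorm M) 2]
  have e2 : τsq * nucNorm D ^ 2 ≤ κ / 4 * F := by
    have := mul_le_mul_of_nonneg_left e1 hτ0
    nlinarith
  have e3 : κ / 4 * F ≤ 3 / 2 * l * nucNorm M := by
    have : 0 ≤ l * nucNorm B := by positivity
    linarith
  have e4 : (κ / 4 * F) ^ 2 ≤ 9 / 2 * l ^ 2 * F := by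
    refine (pow_le_pow_left₀ (by positivity) e3 2).trans ?_
    have : l ^ 2 * nucNorm M ^ 2 ≤ l ^ 2 * (2 * F) := by gcongr; linarith
    nlinarith
  rcases hF0.eq_or_lt with h | h
  · rw [← h]
    positivity
  · rw [← mul_div_assoc, le_div_iff₀ (by positivity)]
    have : F * κ ^ 2 * F ≤ 72 * l ^ 2 * F := by nlinarith
    exact le_of_mul_le_mul_right this h

theorem IsTopEigenvector.rayleigh_le {A : Mat m} (hA : A.IsSymm) {r : ℝ}
    (h : ∀ (q : ℝ) (u : Fin (m + 1) → ℝ), u ≠ 0 → A *ᵥ u = q • u → q ≤ r)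
    (v : Fin (m + 1) → ℝ) : v ⬝ᵥ A *ᵥ v ≤ r * (v ⬝ᵥ v) := by
  obtain ⟨V, d, hV, rfl⟩ := exists_orthogonal_diagonalization hA
  have hV' : V * Vᵀ = 1 := mul_eq_one_comm.1 hV
  have hd (i : Fin (m + 1)) : d i ≤ r := by
    refine h (d i) (V *ᵥ Pi.single i 1) (fun h0 => ?_) ?_
    · have := dotProduct_mulVec_of_orthogonal hV (Pi.single i 1) (Pi.single i 1)
      rw [h0] at this
      simp at this
    · rw [← mulVec_mulVec, mulVec_mulVec _ Vᵀ, hV, one_mulVec, ← mulVec_mulVec, ← mulVec_smul]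
      congr 1
      ext j
      rw [mulVec_diagonal]
      rcases eq_or_ne j i with rfl | hj <;> simp [*]
  have h2 : v ⬝ᵥ v = (Vᵀ *ᵥ v) ⬝ᵥ (Vᵀ *ᵥ v) := by
    rw [mulVec_dotProduct_mulVec, transpose_transpose, hV', one_mulVec]
  rw [← mulVec_mulVec, ← mulVec_mulVec, dotProduct_mulVec, ← mulVec_transpose, h2, dotProduct,
    dotProduct, Finset.mul_sum]
  refine Finset.sum_le_sum fun i _ => ?_
  rw [mulVec_diagonal]
  nlinarith [hd i, mul_self_nonneg ((Vᵀ *ᵥ v) i)]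

/-- The angle between `s` and a top eigenvector of a perturbation of `s sᵀ`. -/
theorem IsTopEigenvector.mul_sub_sq_le {A : Mat m} (hA : A.IsSymm) {u : Fin (m + 1) → ℝ}
    (hu : IsTopEigenvector A u) {s : Fin (m + 1) → ℝ} (hs : 0 < s ⬝ᵥ s) :
    (s ⬝ᵥ s) * (s ⬝ᵥ s - (u ⬝ᵥ s) ^ 2) ≤ 2 * frobSq (A - vecMulVec s s) := by
  obtain ⟨hu1, r, hr, htop⟩ := hu
  have hray := IsTopEigenvector.rayleigh_le hA htop s
  set q := s ⬝ᵥ s with hq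
  set c := u ⬝ᵥ s with hc
  have hsu : s ⬝ᵥ u = c := dotProduct_comm s u
  have hF := frobSq_nonneg (A - vecMulVec s s)
  -- Maximality of `r` says that `A` pairs with `q u uᵀ - s sᵀ` nonnegatively, so `A - s sᵀ` pairs
  -- with it to at least `q (q - c²)`. Its squared norm is `2 q (q - c²)`, and Cauchy-Schwarz
  -- followed by cancellation concludes.
  have h1 : traceInner (A - vecMulVec s s) (q • vecMulVec u u - vecMulVec s s)
      = q * (r - c ^ 2) - (s ⬝ᵥ A *ᵥ s - q ^ 2) := by
    rw [traceInner_sub_right, traceInner_smul_right, traceInner_vecMulVec, traceInner_vecMulVec,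
      sub_mulVec, sub_mulVec, hr, vecMulVec_mulVec, vecMulVec_mulVec]
    simp only [dotProduct_sub, op_smul_eq_smul, dotProduct_smul, hu1, hsu, ← hq, ← hc, smul_eq_mul]
    ring
  have h2 : frobSq (q • vecMulVec u u - vecMulVec s s) = 2 * (q * (q - c ^ 2)) := by
    rw [frobSq, traceInner_sub_right, traceInner_smul_right, traceInner_vecMulVec,
      traceInner_vecMulVec]
    simp only [sub_mulVec, smul_mulVec, vecMulVec_mulVec, dotProduct_sub, op_smul_eq_smul,
      dotProduct_smul, hu1, hsu, ← hq, ← hc, smul_eq_mul]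
    ring
  have h3 := traceInner_sq_le (A - vecMulVec s s) (q • vecMulVec u u - vecMulVec s s)
  have h4 : 0 ≤ q * (q - c ^ 2) := by
    have := dotProduct_sq_le u s
    rw [hu1, one_mul, ← hc, ← hq] at this
    exact mul_nonneg hs.le (by linarith)
  rw [h1, h2] at h3
  have h5 : q * (q - c ^ 2) ≤ q * (r - c ^ 2) - (s ⬝ᵥ A *ᵥ s - q ^ 2) := by nlinarith
  have h6 := (pow_le_pow_left₀ h4 h5 2).trans h3
  rcases h4.eq_or_lt with h | h
  · rw [← h]
    linarith
  · have : q * (q - c ^ 2) * (q * (q - c ^ 2)) ≤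
        2 * frobSq (A - vecMulVec s s) * (q * (q - c ^ 2)) := by nlinarith
    exact le_of_mul_le_mul_right this h

end Estimator

/-! ### The noise event -/

namespace Run

variable {m K : ℕ} {P : Instance m K} {T₁ : ℕ} {b δ : ℝ} {σ : ℝ≥0} {U Ω : Type*}
  [MeasurableSpace U] [MeasurableSpace Ω] {μ : Measure Ω}

/-- A union over test vectors of strict inequalities between continuous functions; used for
measurability of the bad noise set of a fixed design. -/
theorem isOpen_not_isContraction {N : ℕ} (u : ℝ) (A : Fin N → Mat m) :
    IsOpen {x : ℕ → ℝ | ¬ IsContraction u (∑ t : Fin N, x t • A t)} := by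
  have : {x : ℕ → ℝ | ¬ IsContraction u (∑ t : Fin N, x t • A t)} =
      ⋃ v : Fin (m + 1) → ℝ, {x : ℕ → ℝ | u ^ 2 * (v ⬝ᵥ v) <
        ((∑ t : Fin N, x t • A t) *ᵥ v) ⬝ᵥ ((∑ t : Fin N, x t • A t) *ᵥ v)} := by
    ext x
    simp [IsContraction]
  rw [this]
  exact isOpen_iUnion fun v => isOpen_lt (by fun_prop) (by fun_prop)

/-- The regularization parameter dominates the noise with probability `1 - δ`. -/
theorem measure_not_isContraction_noise_le [IsProbabilityMeasure μ] (R : Run P T₁ b δ σ U μ)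
    (hb : 0 < b) (hσ : 2 * (σ : ℝ) ≤ b) (hδ : 0 < δ) (hδ1 : δ < 1) (hT : 0 < T₁) :
    μ {ω | ¬ IsContraction (T₁ * (lam m T₁ b δ / 2))
      (∑ t : Fin T₁, R.noise t ω • R.design ω t)} ≤ ENNReal.ofReal δ := by
  have hT' : (0 : ℝ) < T₁ := by exact_mod_cast hT
  have hlog : 0 < Real.log (2 * ((m : ℝ) + 1) / δ) := by
    refine Real.log_pos ?_
    rw [one_lt_div hδ]
    have : (0 : ℝ) ≤ m := Nat.cast_nonneg m
    linarith
  set u := (T₁ : ℝ) * (lam m T₁ b δ / 2) with hu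
  have hu0 : 0 ≤ u := by
    rw [hu, lam]
    positivity
  -- The design is a function of the seed with values in the finite set `Fin T₁ → Fin K`, so it may
  -- be treated as fixed.
  refine measure_le_of_forall_parameter (E := ℕ → ℝ) (X := fun ω t => R.noise t ω) (e := R.explore)
    (S := fun a => {x : ℕ → ℝ | ¬ IsContraction u (∑ t : Fin T₁, x t • P.arm (a t))})
    R.measurable_seed R.seed_indep (fun a => ?_)
    (fun a => (isOpen_not_isContraction u _).measurableSet) fun a => ?_
  · exact measurable_pi_iff.2 R.measurable_explore (measurableSet_singleton a)
  · have h := measureReal_not_isContraction_le (μ := μ) (g := fun t : Fin T₁ => R.noise t)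
      (v := σ ^ 2) (fun t => R.measurable_noise t) (fun t => R.noise_law t)
      (R.noise_indep.precomp Fin.val_injective) (A := fun t => P.arm (a t))
      (fun t => (P.isLaplacian _).isContraction_forest) (fun t => (P.isLaplacian _).isSymm_forest)
      (u := u) (w := T₁ * (b / 2) ^ 2) hu0 (by positivity) (by
        rw [Fintype.card_fin, NNReal.coe_pow]
        have : (σ : ℝ) ≤ b / 2 := by linarith
        gcongr)
    -- The choice of `λ` makes the exponent equal `log (2n/δ)`, cancelling the prefactor `2n` to
    -- leave `δ`. Using `b / 2` in place of `σ` keeps the variance proxy positive even for `σ = 0`.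
    have e : u ^ 2 / (2 * (T₁ * (b / 2) ^ 2)) = Real.log (2 * ((m : ℝ) + 1) / δ) := by
      rw [hu, lam]
      have := Real.sq_sqrt (by positivity : 0 ≤ 2 * Real.log (2 * ((m : ℝ) + 1) / δ) / (T₁ : ℝ))
      calc _ = (√(2 * Real.log (2 * ((m : ℝ) + 1) / δ) / (T₁ : ℝ))) ^ 2 * T₁ / 2 := by
            field_simp
        _ = _ := by
            rw [this]
            field_simp
    rw [e, Real.exp_neg, Real.exp_log (by positivity), inv_div,
      mul_div_cancel₀ _ (by positivity)] at h
    rw [← ofReal_measureReal]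
    exact ENNReal.ofReal_le_ofReal h

/-! ### The regret -/

theorem loss_sub_redArm_mem_Icc (R : Run P T₁ b δ σ U μ) (ω : Ω) (i : Fin K) :
    P.loss i - R.redArm ω i ⬝ᵥ R.redTheta ω ∈
      Set.Icc 0 (P.signal - ((fun v => R.rot ω v 0) ⬝ᵥ P.s) ^ 2) :=
  traceInner_sub_reduced_mem_Icc (R.rot_orthogonal ω) P.s
    (P.isLaplacian i).dotProduct_forest_mulVec

/-- The regret is at most the regret of the exploration stage, the cost of the reduction to the
estimated subspace, and the regret of the linear bandit algorithm. -/
theorem regret_le (R : Run P T₁ b δ σ U μ) {T : ℕ} (hT : T₁ ≤ T) (ω : Ω) :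
    R.regret T ω ≤ T₁ * P.signal +
      T * (P.signal - ((fun v => R.rot ω v 0) ⬝ᵥ P.s) ^ 2) + R.subRegret T ω := by
  set v := P.signal - ((fun v => R.rot ω v 0) ⬝ᵥ P.s) ^ 2 with hv
  have hinf (t : ℕ) : ∃ j, (⨅ i, P.loss i) = P.loss j := by
    have : Nonempty (Fin K) := ⟨R.played t ω⟩
    obtain ⟨j, hj⟩ := exists_eq_ciInf_of_finite (f := P.loss)
    exact ⟨j, hj.symm⟩
  have h1 : ∑ t ∈ Finset.range T₁, (P.loss (R.played t ω) - ⨅ i, P.loss i) ≤ T₁ * P.signal := by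
    have : ∀ t ∈ Finset.range T₁, P.loss (R.played t ω) - ⨅ i, P.loss i ≤ P.signal := by
      intro t _
      obtain ⟨j, hj⟩ := hinf t
      rw [hj]
      linarith [P.loss_le_signal (R.played t ω), P.loss_nonneg j]
    simpa using Finset.sum_le_card_nsmul _ _ _ this
  have h2 : ∑ t ∈ Finset.Ico T₁ T, (P.loss (R.played t ω) - ⨅ i, P.loss i) ≤
      T * v + R.subRegret T ω := by
    have : ∀ t ∈ Finset.Ico T₁ T, P.loss (R.played t ω) - ⨅ i, P.loss i ≤
        v + (R.redArm ω (R.played t ω) ⬝ᵥ R.redTheta ω - ⨅ i, R.redArm ω i ⬝ᵥ R.redTheta ω) := by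
      intro t _
      obtain ⟨j, hj⟩ := hinf t
      -- The reduction error is one-sided: the upper end is used at the played arm and the lower end
      -- at the optimal one, so a round pays `v` only once.
      have e1 := (R.loss_sub_redArm_mem_Icc ω (R.played t ω)).2
      have e2 := (R.loss_sub_redArm_mem_Icc ω j).1
      have e3 : ⨅ i, R.redArm ω i ⬝ᵥ R.redTheta ω ≤ R.redArm ω j ⬝ᵥ R.redTheta ω :=
        ciInf_le (Set.finite_range _).bddBelow j
      rw [hj]
      linarith
    have hv0 : 0 ≤ v := by
      have h0 := dotProduct_sq_le (fun w => R.rot ω w 0) P.s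
      rw [(R.rot_top ω).1, one_mul] at h0
      exact sub_nonneg.2 h0
    refine (Finset.sum_le_sum this).trans ?_
    rw [Finset.sum_add_distrib, subRegret]
    gcongr
    rw [Finset.sum_const, Nat.card_Ico, nsmul_eq_mul]
    gcongr
    exact Nat.sub_le _ _
  rw [regret, ← Finset.sum_range_add_sum_Ico _ hT]
  linarith

/-- The squared norm of the part of `s` outside the estimated direction. -/
theorem signal_sub_sq_le (R : Run P T₁ b δ σ U μ) {κ τsq : ℝ} (hb : 0 < b) (hδ : 0 < δ)
    (hδ1 : δ < 1) (hT : 0 < T₁) (hκ : 0 < κ) (hs : 0 < P.signal) (hτ0 : 0 ≤ τsq)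
    (hτ : 128 * τsq ≤ κ) {ω : Ω} (hRSC : RSC P.s (R.design ω) κ τsq)
    (hnoise : IsContraction (T₁ * (lam m T₁ b δ / 2))
      (∑ t : Fin T₁, R.noise t ω • R.design ω t)) :
    P.signal * (P.signal - ((fun v => R.rot ω v 0) ⬝ᵥ P.s) ^ 2) ≤
      288 * b ^ 2 * Real.log (2 * ((m : ℝ) + 1) / δ) / (T₁ * κ ^ 2) := by
  have hT' : (0 : ℝ) < T₁ := by exact_mod_cast hT
  have hlog : 0 < Real.log (2 * ((m : ℝ) + 1) / δ) := by
    refine Real.log_pos ?_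
    rw [one_lt_div hδ]
    have : (0 : ℝ) ≤ m := Nat.cast_nonneg m
    linarith
  have hl : 0 < lam m T₁ b δ := by
    rw [lam]
    positivity
  have h1 := RSC.frobSq_sub_le hs hκ hl hT hτ0 hτ hRSC
    ((R.thetaHat_admissible ω).sub P.isAdmissible_theta) hnoise (R.thetaHat_min ω P.theta)
  have h2 := (R.rot_top ω).mul_sub_sq_le (R.thetaHat_admissible ω).1 hs
  have h3 : lam m T₁ b δ ^ 2 = b ^ 2 * (2 * Real.log (2 * ((m : ℝ) + 1) / δ) / T₁) := by
    rw [lam, mul_pow, Real.sq_sqrt (by positivity)]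
  rw [h3] at h1
  calc _ ≤ 2 * frobSq (R.thetaHat ω - vecMulVec P.s P.s) := h2
    _ ≤ 2 * (72 * (b ^ 2 * (2 * Real.log (2 * ((m : ℝ) + 1) / δ) / T₁) / κ ^ 2)) := by gcongr
    _ = _ := by
      field_simp
      ring

end Run

/-! ### Rates -/

/-- A tolerance of the order of uniform sampling is small against the curvature when the exploration
stage is long. -/
theorem tolerance_le {cTau r L n' L₁ T₁ κ τsq : ℝ} (hcTau : 0 < cTau) (hr : r = 256 * cTau + 1)
    (hT₁ : 0 < T₁) (hκ : 0 < κ) (hκ1 : κ ≤ 1) (hn : n' ≤ L) (hL₁ : L₁ ≤ L)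
    (hτ : τsq ≤ cTau * (√(n' / T₁) + L₁ / T₁)) (h : r ^ 2 * L / κ ^ 2 ≤ T₁) :
    128 * τsq ≤ κ := by
  have hr1 : 1 ≤ r := by linarith
  have h0 : L / T₁ ≤ (κ / r) ^ 2 := by
    rw [div_le_iff₀ (by positivity)] at h
    rw [div_pow, div_le_div_iff₀ hT₁ (by positivity)]
    linarith
  have h1 : √(n' / T₁) ≤ κ / r := by
    rw [Real.sqrt_le_left (by positivity)]
    exact (by gcongr : n' / T₁ ≤ L / T₁).trans h0
  -- This tolerance term is linear in `L / T₁`, so its bound is `(κ/r)²`; `κ ≤ 1` reduces it to `κ /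
  -- r`.
  have h2 : L₁ / T₁ ≤ κ / r := by
    refine ((by gcongr : L₁ / T₁ ≤ L / T₁).trans h0).trans ?_
    have : κ / r ≤ 1 := (div_le_one (by positivity)).2 (by linarith)
    have h4 : 0 ≤ κ / r := by positivity
    nlinarith
  have h3 : τsq ≤ cTau * (2 * (κ / r)) := hτ.trans (by gcongr; linarith)
  have h4 : r * (κ / r) = κ := by field_simp
  have h5 : 0 ≤ κ / r := by positivity
  rw [hr] at h4 h3 h5
  linarith

/-- The lower bound on the exploration length for a long horizon. -/
theorem le_exploration_length {cLo c₀ r L ℓ S κ T T₁ : ℝ} (hcLo : 0 < cLo) (hr : 0 < r)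
    (hc₀ : c₀ = (r ^ 2 / cLo) ^ 2) (hL : 0 < L) (hℓ : 0 < ℓ) (hS : ℓ ≤ S) (hκ : 0 < κ)
    (hT : c₀ * (S ^ 2 / κ ^ 2 * L) ≤ T) (hT₁ : cLo * (1 / (ℓ * κ) * √(T * L)) ≤ T₁) :
    r ^ 2 * L / κ ^ 2 ≤ T₁ := by
  refine le_trans ?_ hT₁
  -- The value of `c₀` is the square of the factor needed here, since `T` enters through its square
  -- root.
  have h1 : r ^ 2 / cLo * (ℓ / κ * L) ≤ √(T * L) := by
    refine Real.le_sqrt_of_sq_le ?_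
    calc (r ^ 2 / cLo * (ℓ / κ * L)) ^ 2 = c₀ * (ℓ ^ 2 / κ ^ 2 * L) * L := by
          rw [hc₀]
          field_simp
      _ ≤ c₀ * (S ^ 2 / κ ^ 2 * L) * L := by
          rw [hc₀]
          gcongr
      _ ≤ T * L := by gcongr
  calc r ^ 2 * L / κ ^ 2 = cLo * (1 / (ℓ * κ) * (r ^ 2 / cLo * (ℓ / κ * L))) := by
        field_simp
    _ ≤ _ := by gcongr

/-- The three contributions to the regret for the prescribed exploration length. -/
theorem regret_rate {cLo cHi cL b cSub ℓ S κ T T₁ L Lg n v ρ : ℝ} {p : ℕ}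
    (hcLo : 0 < cLo) (hcHi : 0 < cHi) (hcL : 0 < cL) (hcSub : 0 < cSub) (hℓ : 0 < ℓ)
    (hℓS : ℓ ≤ S) (hSn : S ≤ n) (hn : 1 ≤ n) (hnℓ : cL * n ≤ ℓ) (hκ : 0 < κ) (hκn : κ * n ≤ 5)
    (hT : 0 < T) (hL : 1 ≤ L) (hLg : L ≤ Lg)
    (hlo : cLo * (1 / (ℓ * κ) * √(T * L)) ≤ T₁) (hhi : T₁ ≤ cHi * (1 / (ℓ * κ) * √(T * L)))
    (hv : S * v ≤ 288 * b ^ 2 * L / (T₁ * κ ^ 2))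
    (hρ : ρ ≤ cSub * ((2 * n - 1) * √T) * Lg ^ p) :
    T₁ * S + T * v + ρ ≤ (cHi / cL + 288 * b ^ 2 / cLo + 10 * cSub) * (1 / κ * √(n * T)) *
      Lg ^ (p + 1) := by
  have hS : 0 < S := hℓ.trans_le hℓS
  have hn0 : 0 < n := by linarith
  have hL0 : 0 < L := by linarith
  have hLg1 : 1 ≤ Lg := hL.trans hLg
  -- All three contributions are of order `√T / κ` up to logarithms; the factor `√n` enters only
  -- through this slack.
  have hsqrt : √T ≤ √(n * T) := Real.sqrt_le_sqrt (by nlinarith)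
  have hTL : √(T * L) ≤ √(n * T) * Lg ^ (p + 1) := by
    rw [Real.sqrt_mul hT.le]
    have h1 : √L ≤ L := by
      rw [Real.sqrt_le_left hL0.le]
      nlinarith
    have h2 : Lg ≤ Lg ^ (p + 1) := le_self_pow₀ hLg1 (by omega)
    gcongr
    linarith
  have hTLpos : 0 < √(T * L) := by positivity
  have e1 : T₁ * S ≤ cHi / cL * (1 / κ * √(T * L)) := by
    have : S / ℓ ≤ 1 / cL := by
      rw [div_le_div_iff₀ hℓ hcL]
      nlinarith
    calc T₁ * S ≤ cHi * (1 / (ℓ * κ) * √(T * L)) * S := by gcongr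
      _ = cHi * (S / ℓ) * (1 / κ * √(T * L)) := by field_simp
      _ ≤ cHi * (1 / cL) * (1 / κ * √(T * L)) := by gcongr
      _ = _ := by ring
  have e2 : T * v ≤ 288 * b ^ 2 / cLo * (1 / κ * √(T * L)) := by
    have h1 : v ≤ 288 * b ^ 2 * L / (T₁ * κ ^ 2) / S := by
      rw [le_div_iff₀ hS]
      linarith
    have h2 : 288 * b ^ 2 * L / (T₁ * κ ^ 2) / S ≤
        288 * b ^ 2 * L / (cLo * (1 / (ℓ * κ) * √(T * L)) * κ ^ 2) / ℓ := by gcongr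
    have h3 : T * L = √(T * L) * √(T * L) := (Real.mul_self_sqrt (by positivity)).symm
    calc T * v ≤ T * (288 * b ^ 2 * L / (cLo * (1 / (ℓ * κ) * √(T * L)) * κ ^ 2) / ℓ) := by
          gcongr
          exact h1.trans h2
      _ = 288 * b ^ 2 / cLo * (1 / κ * (T * L / √(T * L))) := by field_simp
      _ = _ := by
          nth_rewrite 1 [h3]
          rw [mul_self_div_self]
  -- The dimension `2n - 1` is traded for `10 / κ` by `κ n ≤ 5`.
  have e3 : ρ ≤ 10 * cSub * (1 / κ * √T) * Lg ^ p := by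
    refine hρ.trans ?_
    have : 2 * n - 1 ≤ 10 * (1 / κ) := by
      rw [mul_one_div, le_div_iff₀ hκ]
      linarith
    calc _ ≤ cSub * (10 * (1 / κ) * √T) * Lg ^ p := by gcongr
      _ = _ := by ring
  have e4 : Lg ^ p ≤ Lg ^ (p + 1) := pow_le_pow_right₀ hLg1 (by omega)
  calc T₁ * S + T * v + ρ
      ≤ cHi / cL * (1 / κ * √(T * L)) + 288 * b ^ 2 / cLo * (1 / κ * √(T * L)) +
        10 * cSub * (1 / κ * √T) * Lg ^ p := by linarith
    _ ≤ cHi / cL * (1 / κ * (√(n * T) * Lg ^ (p + 1))) +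
        288 * b ^ 2 / cLo * (1 / κ * (√(n * T) * Lg ^ (p + 1))) +
        10 * cSub * (1 / κ * √(n * T)) * Lg ^ (p + 1) := by gcongr
    _ = _ := by ring

end OPDMin

end

/-! ### Assembly of the regret bound -/

theorem mainTheorem4
    -- the constants of the problem
    (cLo cHi cL cTau b cSub : ℝ) (pSub : ℕ)
    (hcLo : 0 < cLo) (hcHi : 0 < cHi) (hcL : 0 < cL) (hcTau : 0 < cTau) (hb : 0 < b)
    (hcSub : 0 < cSub) :
    ∃ (C c₀ : ℝ) (p : ℕ), 0 < C ∧ 0 < c₀ ∧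
      ∀ (m K : ℕ) (P : OPDMin.Instance m K) (T T₁ : ℕ) (δ κ τsq ℓ δ₁ δ₂ : ℝ) (σ : ℝ≥0)
        (U Ω : Type*) [MeasurableSpace U] [MeasurableSpace Ω]
        (μ : Measure Ω) [IsProbabilityMeasure μ]
        (R : OPDMin.Run P T₁ b δ σ U μ),
        0 < δ → δ < 1 → 0 < κ → 0 ≤ τsq → 0 ≤ δ₁ → 0 ≤ δ₂ → 2 * (σ : ℝ) ≤ b →
        -- the known lower bound on the signal strength, of order `|V|`
        0 < ℓ → ℓ ≤ P.signal → cL * ((m : ℝ) + 1) ≤ ℓ →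
        -- the exploration length
        T₁ ≤ T →
        cLo * (1 / (ℓ * κ) * √((T : ℝ) * Real.log (2 * ((m : ℝ) + 1) / δ))) ≤ (T₁ : ℝ) →
        (T₁ : ℝ) ≤ cHi * (1 / (ℓ * κ) * √((T : ℝ) * Real.log (2 * ((m : ℝ) + 1) / δ))) →
        -- the tolerance is small against the curvature, or has the order that it has for uniform
        -- sampling and the horizon is long
        (128 * τsq ≤ κ ∨
          (κ ≤ 1 ∧
            τsq ≤ cTau * (√(Real.log (2 * ((m : ℝ) + 1)) / (T₁ : ℝ))
              + Real.log (1 / δ) / (T₁ : ℝ)) ∧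
            c₀ * (P.signal ^ 2 / κ ^ 2 * Real.log (2 * ((m : ℝ) + 1) / δ)) ≤ (T : ℝ))) →
        -- restricted strong convexity, up to probability `δ₁`
        μ {ω | ¬ OPDMin.RSC P.s (R.design ω) κ τsq} ≤ ENNReal.ofReal δ₁ →
        -- the regret bound of the linear bandit algorithm, up to probability `δ₂`
        μ {ω | cSub * ((2 * ((m : ℝ) + 1) - 1) * √(T : ℝ))
              * Real.log (2 * ((m : ℝ) + 1) * (T : ℝ) / δ) ^ pSub
            < R.subRegret T ω} ≤ ENNReal.ofReal δ₂ →
        -- the regret bound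
        μ {ω | C * (1 / κ * √(((m : ℝ) + 1) * (T : ℝ)))
              * Real.log (2 * ((m : ℝ) + 1) * (T : ℝ) / δ) ^ p
            < R.regret T ω} ≤ ENNReal.ofReal (δ + δ₁ + δ₂) := by
  -- The three summands pay for exploration, the subspace error and the second stage.
  refine ⟨cHi / cL + 288 * b ^ 2 / cLo + 10 * cSub, ((256 * cTau + 1) ^ 2 / cLo) ^ 2, pSub + 1,
    by positivity, by positivity, ?_⟩
  intro m K P T T₁ δ κ τsq ℓ δ₁ δ₂ σ U Ω _ _ μ _ R hδ hδ1 hκ hτ0 hδ₁ hδ₂ hσ hℓ hℓS hcℓ hT₁T hlo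
    hhi hτ hRSC hSub
  have hm0 : (0 : ℝ) ≤ m := Nat.cast_nonneg m
  have hS : 0 < P.signal := hℓ.trans_le hℓS
  have hm : (1 : ℝ) ≤ m := by
    rcases Nat.eq_zero_or_pos m with rfl | h
    · have h0 : P.s 0 = 0 := by simpa using P.centered
      have h1 : P.signal = 0 := by simp [OPDMin.Instance.signal, dotProduct, h0]
      exact absurd h1 hS.ne'
    · exact_mod_cast h
  rcases Nat.eq_zero_or_pos T with rfl | hT
  · have h0 : ∀ ω, R.regret 0 ω = 0 := fun ω => by simp [OPDMin.Run.regret]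
    simp [h0]
  have hT' : (1 : ℝ) ≤ T := by exact_mod_cast hT
  have hT0 : (0 : ℝ) < T := by linarith
  set L := Real.log (2 * ((m : ℝ) + 1) / δ) with hLdef
  set Lg := Real.log (2 * ((m : ℝ) + 1) * (T : ℝ) / δ) with hLgdef
  have hfour : 4 ≤ 2 * ((m : ℝ) + 1) / δ := by
    rw [le_div_iff₀ hδ]
    linarith
  have hL1 : 1 ≤ L := by
    rw [hLdef, Real.le_log_iff_exp_le (by linarith)]
    linarith [Real.exp_one_lt_d9]
  have hL0 : 0 < L := by linarith
  have hLLg : L ≤ Lg := by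
    refine Real.log_le_log (by linarith) ?_
    exact div_le_div_of_nonneg_right (le_mul_of_one_le_right (by positivity) hT') hδ.le
  have hT₁pos : (0 : ℝ) < T₁ := lt_of_lt_of_le (by positivity) hlo
  have hT₁ : 0 < T₁ := by exact_mod_cast hT₁pos
  have hτκ : 128 * τsq ≤ κ := by
    rcases hτ with h | ⟨hκ1, hτ, hlong⟩
    · exact h
    · have hlen := OPDMin.le_exploration_length hcLo (by positivity : 0 < 256 * cTau + 1) rfl hL0 hℓ
        hℓS hκ hlong hlo
      refine OPDMin.tolerance_le hcTau rfl hT₁pos hκ hκ1 ?_ ?_ hτ hlen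
      · refine Real.log_le_log (by positivity) ?_
        rw [le_div_iff₀ hδ]
        nlinarith
      · refine Real.log_le_log (by positivity) ?_
        gcongr
        linarith
  set A := {ω | ¬ OPDMin.RSC P.s (R.design ω) κ τsq}
  set B := {ω | cSub * ((2 * ((m : ℝ) + 1) - 1) * √(T : ℝ)) * Lg ^ pSub < R.subRegret T ω}
  set E := {ω | ¬ OPDMin.IsContraction (T₁ * (OPDMin.lam m T₁ b δ / 2))
    (∑ t : Fin T₁, R.noise t ω • R.design ω t)}
  have hE : μ E ≤ ENNReal.ofReal δ :=
    R.measure_not_isContraction_noise_le hb hσ hδ hδ1 hT₁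
  have hsub : {ω | (cHi / cL + 288 * b ^ 2 / cLo + 10 * cSub) *
      (1 / κ * √(((m : ℝ) + 1) * (T : ℝ))) * Lg ^ (pSub + 1) < R.regret T ω} ⊆ E ∪ A ∪ B := by
    intro ω hω
    by_contra hgood
    simp only [Set.mem_union, not_or] at hgood
    obtain ⟨⟨hωE, hωA⟩, hωB⟩ := hgood
    have hgE := not_not.1 hωE
    have hgA := not_not.1 hωA
    have hgB : R.subRegret T ω ≤ cSub * ((2 * ((m : ℝ) + 1) - 1) * √(T : ℝ)) * Lg ^ pSub :=
      not_lt.1 hωB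
    have hκm := OPDMin.RSC.curvature_le hS P.centered
      (fun t => (P.isLaplacian _).isContraction_forest)
      (fun t => (P.isLaplacian _).isSymm_forest) hτ0 hgA
    -- Here `4 τ² ≤ κ / 32` and `m + 1 ≤ 2 m`, so the curvature bound gives at most `128 / 31`.
    have hκn : κ * ((m : ℝ) + 1) ≤ 5 := by nlinarith
    have hv := R.signal_sub_sq_le hb hδ hδ1 hT₁ hκ hS hτ0 hτκ hgA hgE
    have hrate := OPDMin.regret_rate hcLo hcHi hcL hcSub hℓ hℓS P.signal_le (by linarith) hcℓ hκ
      hκn hT0 hL1 hLLg hlo hhi hv hgB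
    exact absurd hω (not_lt.2 ((R.regret_le hT₁T ω).trans hrate))
  -- Monotonicity and subadditivity hold for `μ` as an outer measure, so no measurability of these
  -- events is required.
  calc _ ≤ μ (E ∪ A ∪ B) := measure_mono hsub
    _ ≤ μ E + μ A + μ B :=
      (measure_union_le _ _).trans (add_le_add_left (measure_union_le _ _) _)
    _ ≤ ENNReal.ofReal δ + ENNReal.ofReal δ₁ + ENNReal.ofReal δ₂ := by gcongr
    _ = ENNReal.ofReal (δ + δ₁ + δ₂) := by
      rw [ENNReal.ofReal_add (by positivity) hδ₂, ENNReal.ofReal_add hδ.le hδ₁]
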